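/- Let $\ell\ge 5$ be prime and let $\mathbb{Z}_{(\ell)}=\{a/b\in\mathbb{Q}:\ell\nmid b\}$. For $k\in\mathbb{Z}$, let $M_k$ be the set of modular forms of weight $k$ on $\mathrm{SL}_2(\mathbb{Z})$ whose Fourier coefficients (in $q=e^{2\pi i\tau}$) lie in $\mathbb{Z}_{(\ell)}$. Congruences of $q$-series mod $\ell$ are understood coefficientwise in $\mathbb{Z}_{(\ell)}$. For a power series $f\in\mathbb{Z}_{(\ell)}[[q]]$ congruent mod $\ell$ to a modular form, its filtration is $$\omega(f)=\inf\{k\in\mathbb{Z} : f\equiv g \bmod \ell \text{ for some } g\in M_k\},$$ (so $\omega(f)=-\infty$ if $f\equiv 0\bmod \ell$). A series $f=\sum a(n)q^n$ has a simple congruence at $c \bmod \ell$ if $a(\ell n+c)\equiv 0 \bmod \ell$ for all $n\in\mathbb{Z}$ (with $a(m)=0$ for $m$ outside the support of the series). Lemma. Suppose $f\in M_k$ has a simple congruence at $c\not\equiv 0\bmod \ell$. If $\omega(f)=A\ell+B$ with integers $A,B$ and $1\le B\le \ell-1$, then $$\frac{\ell+1}{2}\le B\le A+\frac{\ell+3}{2}.$$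 -/

import Mathlib

open scoped MatrixGroups

namespace SimpleCongruence

/-- The ring `ℤ_(ℓ) = {a / b ∈ ℚ : ℓ ∤ b}`. -/
def ZLoc (ℓ : ℕ) [hℓ : Fact ℓ.Prime] : Subring ℚ where
  carrier := {x | ∃ a b : ℤ, ¬ (ℓ : ℤ) ∣ b ∧ x = (a : ℚ) / (b : ℚ)}
  zero_mem' := ⟨0, 1, fun h => hℓ.out.one_lt.ne' (by simpa using Int.natCast_dvd.mp h), by simp⟩
  one_mem' := ⟨1, 1, fun h => hℓ.out.one_lt.ne' (by simpa using Int.natCast_dvd.mp h), by simp⟩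
  neg_mem' := by
    rintro x ⟨a, b, hb, rfl⟩
    exact ⟨-a, b, hb, by push_cast; ring⟩
  add_mem' := by
    rintro x y ⟨a, b, hb, rfl⟩ ⟨c, d, hd, rfl⟩
    have hb0 : (b : ℚ) ≠ 0 := by
      rintro h
      exact hb (by simp [Int.cast_eq_zero.mp h])
    have hd0 : (d : ℚ) ≠ 0 := by
      rintro h
      exact hd (by simp [Int.cast_eq_zero.mp h])
    refine ⟨a * d + b * c, b * d, fun h => ?_, ?_⟩
    · exact ((Nat.prime_iff_prime_int.mp hℓ.out).dvd_or_dvd h).elim hb hd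
    · push_cast
      exact div_add_div _ _ hb0 hd0
  mul_mem' := by
    rintro x y ⟨a, b, hb, rfl⟩ ⟨c, d, hd, rfl⟩
    refine ⟨a * c, b * d, fun h => ?_, ?_⟩
    · exact ((Nat.prime_iff_prime_int.mp hℓ.out).dvd_or_dvd h).elim hb hd
    · push_cast
      exact div_mul_div_comm _ _ _ _

/-- A Laurent series `∑ a(n) qⁿ` over `ℤ_(ℓ)` has a simple congruence at `c mod ℓ` if
`a(ℓ n + c) ≡ 0 mod ℓ` for all integers `n`. -/
def HasSimpleCongruence (ℓ : ℕ) [Fact ℓ.Prime] (f : LaurentSeries (ZLoc ℓ)) (c : ℤ) : Prop :=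
  ∀ n : ℤ, (ℓ : ZLoc ℓ) ∣ f.coeff ((ℓ : ℤ) * n + c)

/-- `f ≡ g mod ℓ` for power series over `ℤ_(ℓ)`: coefficientwise congruence. -/
def CongrMod (ℓ : ℕ) [Fact ℓ.Prime] (f g : PowerSeries (ZLoc ℓ)) : Prop :=
  ∀ n : ℕ, (ℓ : ZLoc ℓ) ∣ PowerSeries.coeff n f - PowerSeries.coeff n g

/-- The set `M_k` of modular forms of weight `k` on `SL₂(ℤ)` with `ℓ`-integral Fourier
coefficients, each identified with its Fourier expansion in `q = exp (2 π i τ)`. -/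
def M (ℓ : ℕ) [Fact ℓ.Prime] (k : ℤ) : Set (PowerSeries (ZLoc ℓ)) :=
  {f | ∃ F : ModularForm 𝒮ℒ k,
    UpperHalfPlane.qExpansion 1 F = PowerSeries.map (algebraMap (ZLoc ℓ) ℂ) f}

/-- The filtration `ω(f) = inf {k : f ≡ g mod ℓ for some g ∈ M_k}`, the infimum being taken in
the integers extended by `⊥ = -∞` and `⊤ = +∞` (it is `-∞` when `f ≡ 0 mod ℓ`). -/
noncomputable def filtration (ℓ : ℕ) [Fact ℓ.Prime] (f : PowerSeries (ZLoc ℓ)) :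
    WithBot (WithTop ℤ) :=
  sInf {x | ∃ k : ℤ, x = ((k : WithTop ℤ) : WithBot (WithTop ℤ)) ∧ ∃ g ∈ M ℓ k, CongrMod ℓ f g}

end SimpleCongruence

/-! Forms mod `ℓ` are studied in the graded ring 𝔽_ℓ[X₀, X₁], mapped by `phi` to the reductions of
polynomials in E₄ and E₆. The Eisenstein series of weight ℓ - 1 gives a homogeneous polynomial A
with `phi ℓ A = 1`, and f has filtration n when it is the image of a polynomial of weight n not
divisible by A.

Ramanujan's equations lift 12 q d/dq to a derivation D = `thetaLift A` of weight ℓ + 1 that kills A.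
Since A is squarefree and prime to `del ℓ A`, applying D to a polynomial prime to no multiple of A
can create a factor A only when the weight is divisible by ℓ (`not_dvd_thetaLift`).

Off the residue c, Fermat gives (x^ℓ - c^ℓ)/(x - c) = 1. With x = 12 q d/dq, a simple congruence
thus yields a linear relation among D f, ..., D^(ℓ-1) f. Separating weights mod ℓ - 1
(`sum_phi_eq_zero_of_class`) leaves two terms: with ℓ = 2q + 1, D^(q+1) f = u A^(q+1) D f and u ≠ 0
(`iterate_thetaLift_eq`).

So q + 1 factors A must appear along the iteration (`weight_bounds`). The weight mod ℓ grows by 1 at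
each step, starting from B. If B ≤ q it never reaches 0 in time and no factor appears, whence the
lower bound. Otherwise it reaches 0 after ℓ - B steps, and the next application must supply at least
q + 1 factors at once; the cofactor still has nonnegative weight, which is the upper bound. -/

namespace SimpleCongruence

/-! ### Holomorphic functions with a q-expansion -/

section QExpansions

open UpperHalfPlane ModularForm EisensteinSeries Derivative Function
open scoped Manifold

/-- The operator `q d/dq` on formal power series. -/
noncomputable def theta (R : Type*) [CommRing R] :
    Derivation R (PowerSeries R) (PowerSeries R) :=
  (PowerSeries.X : PowerSeries R) • PowerSeries.derivative R

lemma coeff_theta {R : Type*} [CommRing R] (n : ℕ) (f : PowerSeries R) :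
    (theta R f).coeff n = n * f.coeff n := by
  rw [theta, Derivation.smul_apply, smul_eq_mul]
  cases n with
  | zero => simp
  | succ n => rw [PowerSeries.coeff_succ_X_mul, PowerSeries.coeff_derivative]; push_cast; ring

lemma map_theta {R S : Type*} [CommRing R] [CommRing S] (g : R →+* S) (f : PowerSeries R) :
    PowerSeries.map g (theta R f) = theta S (PowerSeries.map g f) := by
  ext n
  simp [coeff_theta]

/-- `F` is holomorphic on the upper half plane and given there by the power series `p`
in `q = exp (2 π i τ)`. -/
def HasQExp (F : ℍ → ℂ) (p : PowerSeries ℂ) : Prop :=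
  MDiff F ∧ ∀ τ : ℍ, HasSum (fun m ↦ p.coeff m • Periodic.qParam 1 τ ^ m) (F τ)

namespace HasQExp

variable {F G : ℍ → ℂ} {p r : PowerSeries ℂ}

lemma bounded (h : HasQExp F p) : IsBoundedAtImInfty F :=
  isBoundedAtImInfty_of_hasSum_qExpansion one_pos h.2

lemma periodic (h : HasQExp F p) : Periodic (F ∘ ofComplex) (1 : ℝ) := by
  intro w
  by_cases! hw : 0 < w.im
  · have hw1 : 0 < (w + (1 : ℝ)).im := by simpa using hw
    have h1 := h.2 ⟨w, hw⟩
    have h2 := h.2 ⟨w + (1 : ℝ), hw1⟩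
    have : Periodic.qParam 1 (w + (1 : ℝ)) = Periodic.qParam 1 w := by
      simp only [Periodic.qParam, Complex.ofReal_one, div_one, mul_add, mul_one]
      exact Complex.exp_periodic _
    simp only [comp_apply, ofComplex_apply_of_im_pos hw1, ofComplex_apply_of_im_pos hw]
    refine h2.unique ?_
    simpa only [this] using h1
  · have hw1 : (w + (1 : ℝ)).im ≤ 0 := by simpa using hw
    simp only [comp_apply, ofComplex_apply_of_im_nonpos hw1, ofComplex_apply_of_im_nonpos hw]

lemma analyticAt (h : HasQExp F p) : AnalyticAt ℂ (cuspFunction 1 F) 0 :=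
  UpperHalfPlane.analyticAt_cuspFunction_zero (f := F) (h := 1) one_pos h.periodic h.1 h.bounded

lemma qExpansion_eq (h : HasQExp F p) : qExpansion 1 F = p := by
  ext m
  have h1 := (hasFPowerSeriesOnBall_cuspFunction one_pos h.analyticAt h.2).hasFPowerSeriesAt
  have h2 := (hasFPowerSeriesOnBall_cuspFunction one_pos h.analyticAt
    (hasSum_qExpansion one_pos h.periodic h.1 h.bounded)).hasFPowerSeriesAt
  simpa using congr_arg (FormalMultilinearSeries.coeff · m) (h2.eq_formalMultilinearSeries h1)

lemma of_periodic (hp : Periodic (F ∘ ofComplex) (1 : ℝ)) (hd : MDiff F)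
    (hb : IsBoundedAtImInfty F) : HasQExp F (qExpansion 1 F) :=
  ⟨hd, hasSum_qExpansion one_pos hp hd hb⟩

lemma mul (hF : HasQExp F p) (hG : HasQExp G r) : HasQExp (F * G) (p * r) := by
  have := of_periodic (F := F * G) (hF.periodic.mul hG.periodic) (hF.1.mul hG.1)
    (hF.bounded.mul hG.bounded)
  rwa [qExpansion_mul hF.analyticAt hG.analyticAt, hF.qExpansion_eq, hG.qExpansion_eq] at this

lemma smul (hF : HasQExp F p) (a : ℂ) : HasQExp (a • F) (a • p) := by
  refine ⟨hF.1.const_smul a, fun τ ↦ ?_⟩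
  simpa [mul_assoc] using (hF.2 τ).mul_left a

lemma sub (hF : HasQExp F p) (hG : HasQExp G r) : HasQExp (F - G) (p - r) := by
  refine ⟨hF.1.sub hG.1, fun τ ↦ ?_⟩
  simpa [sub_mul] using (hF.2 τ).sub (hG.2 τ)

/-- Writing F(τ) = g(q), the chain rule turns (2πi)⁻¹ d/dτ into q g'(q), whose Taylor series is the
termwise derivative. -/
lemma deriv (hF : HasQExp F p) : HasQExp (normalizedDerivOfComplex F) (theta ℂ p) := by
  refine ⟨normalizedDerivOfComplex_mdifferentiable hF.1, fun τ ↦ ?_⟩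
  set g := cuspFunction 1 F with hg
  have hdiff : DifferentiableOn ℂ g (Metric.ball 0 1) :=
    differentiableOn_cuspFunction_ball one_pos hF.periodic hF.1 hF.bounded
  have hcoeff : ∀ n, p.coeff n = (n.factorial : ℂ)⁻¹ * iteratedDeriv n g 0 := by
    intro n
    rw [← hF.qExpansion_eq, qExpansion_coeff]
  set q := Periodic.qParam 1 (τ : ℂ) with hq
  have hqball : q ∈ Metric.ball (0 : ℂ) 1 := by
    simpa using Periodic.norm_qParam_lt_one one_pos τ.im_pos
  have hD : normalizedDerivOfComplex F τ = q * _root_.deriv g q := by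
    have hqd : HasDerivAt (fun z : ℂ ↦ Periodic.qParam 1 z) (q * (2 * Real.pi * Complex.I)) τ := by
      have : HasDerivAt (fun z : ℂ ↦ 2 * Real.pi * Complex.I * z / (1 : ℝ))
          (2 * Real.pi * Complex.I) (τ : ℂ) := by
        simpa using (hasDerivAt_id (τ : ℂ)).const_mul (2 * Real.pi * Complex.I)
      exact this.cexp
    have hgd : HasDerivAt g (_root_.deriv g q) (Periodic.qParam 1 (τ : ℂ)) :=
      (hdiff.differentiableAt (Metric.isOpen_ball.mem_nhds hqball)).hasDerivAt
    have hev : (F ∘ ofComplex) =ᶠ[nhds (τ : ℂ)] fun z ↦ g (Periodic.qParam 1 z) := by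
      filter_upwards [isOpen_upperHalfPlaneSet.mem_nhds τ.im_pos] with z hz
      have := eq_cuspFunction (f := F) ⟨z, hz⟩ one_ne_zero hF.periodic
      simp only [comp_apply, ofComplex_apply_of_im_pos hz]
      exact this.symm
    rw [normalizedDerivOfComplex, ((hgd.comp (τ : ℂ) hqd).congr_of_eventuallyEq hev).deriv]
    have := Complex.two_pi_I_ne_zero
    field_simp
  have hsum := (Complex.hasSum_taylorSeries_on_ball (hdiff.deriv Metric.isOpen_ball) hqball).mul_left q
  -- The constant term of `theta ℂ p` is zero; dropping it aligns the indices with q times the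
  -- Taylor series of g'.
  rw [hD, ← hasSum_nat_add_iff' 1]
  convert! hsum using 1
  · ext n
    rw [coeff_theta, hcoeff, ← iteratedDeriv_succ', Nat.factorial_succ]
    have : (n.factorial : ℂ) ≠ 0 := by exact_mod_cast n.factorial_ne_zero
    have : (n + 1 : ℂ) ≠ 0 := by exact_mod_cast n.succ_ne_zero
    simp only [smul_eq_mul, sub_zero]
    push_cast
    field_simp
    ring
  · simp [coeff_theta]

lemma serreDerivative {E : PowerSeries ℂ} (hE : HasQExp E2 E) (hF : HasQExp F p) (k : ℂ) :
    HasQExp (serreDerivative k F) (theta ℂ p - (k * 12⁻¹) • (E * p)) := by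
  convert hF.deriv.sub ((hE.mul hF).smul (k * 12⁻¹)) using 1
  ext z
  simp [mul_assoc]

end HasQExp

lemma hasQExp_coe {k : ℤ} (F : ModularForm 𝒮ℒ k) : HasQExp F (qExpansion 1 F) :=
  ⟨ModularFormClass.holo F, fun τ ↦ by
    have : Fact (IsCusp OnePoint.infty 𝒮ℒ) :=
      ⟨Subgroup.isCusp_of_mem_strictPeriods one_pos one_mem_strictPeriods_SL⟩
    exact ModularForm.hasSum_qExpansion F one_pos one_mem_strictPeriods_SL τ⟩

/-- Every cusp is an SL₂(ℤ)-translate of ∞, so invariance reduces boundedness at all cusps to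
boundedness at ∞, which the q-expansion gives. -/
lemma exists_modularForm_coe_eq {k : ℤ} {F : ℍ → ℂ} {p : PowerSeries ℂ} (hF : HasQExp F p)
    (hs : ∀ γ : SL(2, ℤ), F ∣[k] γ = F) : ∃ G : ModularForm 𝒮ℒ k, ⇑G = F :=
  ⟨{ toFun := F
     slash_action_eq' := fun _ ⟨γ, hγ⟩ ↦ hγ ▸ hs γ
     holo' := hF.1
     bdd_at_cusps' := fun {c} hc ↦ by
      rw [Subgroup.IsArithmetic.isCusp_iff_isCusp_SL2Z] at hc
      rw [OnePoint.isBoundedAt_iff_forall_SL2Z hc]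
      intro γ _
      rw [hs γ]
      exact hF.bounded }, rfl⟩

/-- Two forms of weight less than 12 with the same constant term have the same
`q`-expansion. -/
lemma qExpansion_eq_of_weight_lt_twelve {k : ℤ} (hk : k < 12) (F G : ModularForm 𝒮ℒ k)
    (h0 : (qExpansion 1 F).coeff 0 = (qExpansion 1 G).coeff 0) :
    qExpansion 1 F = qExpansion 1 G := by
  rw [← sub_eq_zero, ← ModularForm.qExpansion_sub one_pos one_mem_strictPeriods_SL]
  have : F - G = 0 := by
    apply sturm_bound_levelOne
    have : k.toNat / 12 = 0 := by omega
    rw [this]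
    refine lt_of_lt_of_le (b := ((1 : ℕ) : ℕ∞)) (by norm_num) (PowerSeries.nat_le_order _ _ ?_)
    intro i hi
    obtain rfl : i = 0 := by omega
    rw [FunLike.coe_sub, ModularForm.qExpansion_sub one_pos one_mem_strictPeriods_SL, map_sub, h0,
      sub_self]
  rw [← FunLike.coe_sub, this]
  simpa using qExpansion_zero 1

lemma slash_eq {k : ℤ} (F : ModularForm 𝒮ℒ k) (γ : SL(2, ℤ)) : ⇑F ∣[k] γ = F :=
  F.slash_action_eq' _ ⟨γ, rfl⟩

end QExpansions

end SimpleCongruence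

namespace SimpleCongruence

/-! ### Ramanujan's differential equations -/

section Ramanujan

open UpperHalfPlane ModularForm EisensteinSeries Derivative Function
open scoped Manifold ModularForm ArithmeticFunction.sigma

/-- The `q`-expansion of the Eisenstein series `E₂`. -/
def eisP : PowerSeries ℤ := .mk fun m ↦ if m = 0 then 1 else -24 * σ 1 m

/-- The `q`-expansion of the Eisenstein series `E₄`. -/
def eisQ : PowerSeries ℤ := .mk fun m ↦ if m = 0 then 1 else 240 * σ 3 m

/-- The `q`-expansion of the Eisenstein series `E₆`. -/
def eisR : PowerSeries ℤ := .mk fun m ↦ if m = 0 then 1 else -504 * σ 5 m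

lemma hasQExp_E2 : HasQExp E2 (PowerSeries.map (Int.castRingHom ℂ) eisP) := by
  refine ⟨E2_mdifferentiable, fun τ ↦ ?_⟩
  convert! hasSum_qExpansion_E2 (z := τ) using 2 with m
  simp only [eisP, PowerSeries.coeff_map, PowerSeries.coeff_mk, Periodic.qParam,
    Complex.ofReal_one, div_one]
  split_ifs <;> simp

lemma qExpansion_E₄ : qExpansion 1 E₄ = PowerSeries.map (Int.castRingHom ℂ) eisQ := by
  ext m
  rw [E_qExpansion_coeff _ ⟨2, rfl⟩]
  simp only [eisQ, PowerSeries.coeff_map, PowerSeries.coeff_mk]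
  split_ifs <;> norm_num [show bernoulli 4 = -1 / 30 by decide +kernel]

lemma qExpansion_E₆ : qExpansion 1 E₆ = PowerSeries.map (Int.castRingHom ℂ) eisR := by
  ext m
  rw [E_qExpansion_coeff _ ⟨3, rfl⟩]
  simp only [eisR, PowerSeries.coeff_map, PowerSeries.coeff_mk]
  split_ifs <;> norm_num [show bernoulli 6 = 1 / 42 by decide +kernel]

lemma constantCoeff_eis_int : eisP.constantCoeff = 1 ∧ eisQ.constantCoeff = 1 ∧
    eisR.constantCoeff = 1 := by
  simp [← PowerSeries.coeff_zero_eq_constantCoeff_apply, eisP, eisQ, eisR]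

lemma constantCoeff_eis {A : Type*} [CommRing A] (g : ℤ →+* A) :
    (PowerSeries.map g eisP).constantCoeff = 1 ∧ (PowerSeries.map g eisQ).constantCoeff = 1 ∧
    (PowerSeries.map g eisR).constantCoeff = 1 := by
  simp only [← PowerSeries.coeff_zero_eq_constantCoeff_apply, PowerSeries.coeff_map]
  simp [constantCoeff_eis_int]

lemma normalizedDerivOfComplex_D2 (γ : SL(2, ℤ)) (z : ℍ) :
    normalizedDerivOfComplex (D2 γ) z = -((γ 1 0 : ℂ) / denom γ z) ^ 2 := by
  have h1 : HasDerivAt (fun w : ℂ ↦ (2 * Real.pi * Complex.I * γ 1 0) * denom γ w ^ (-1 : ℤ))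
      ((2 * Real.pi * Complex.I * γ 1 0) * (((-1 : ℤ) : ℂ) * (γ 1 0 : ℂ) *
        denom γ z ^ ((-1 : ℤ) - 1))) z := by
    simpa using (hasDerivAt_denom_zpow (γ : GL (Fin 2) ℝ) (-1) z).const_mul
      (2 * Real.pi * Complex.I * γ 1 0)
  have hev : (D2 γ ∘ ofComplex) =ᶠ[nhds (z : ℂ)]
      fun w : ℂ ↦ (2 * Real.pi * Complex.I * γ 1 0) * denom γ w ^ (-1 : ℤ) := by
    filter_upwards [isOpen_upperHalfPlaneSet.mem_nhds z.im_pos] with w hw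
    simp only [comp_apply, ofComplex_apply_of_im_pos hw, D2, zpow_neg_one, div_eq_mul_inv]
  rw [normalizedDerivOfComplex, (h1.congr_of_eventuallyEq hev).deriv]
  have := Complex.two_pi_I_ne_zero
  have := denom_ne_zero γ z
  rw [show ((-1 : ℤ) - 1) = -2 by norm_num, zpow_neg]
  norm_cast
  field_simp
  simp [sq]

/-- E₂ is only quasimodular: its slash differs by a multiple of `D2 γ`. The corrections this causes
in the derivative of E₂ and in E₂² / 12 cancel. -/
lemma serreDerivative_E2_slash (γ : SL(2, ℤ)) :
    serreDerivative 1 E2 ∣[(4 : ℤ)] γ = serreDerivative 1 E2 := by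
  ext z
  have hE : E2 ∣[(2 : ℤ)] γ = E2 - (1 / (2 * riemannZeta 2)) • D2 γ := E2_slash_action γ
  have hDmd : MDiff (D2 γ) := by
    have h2 : (1 / (2 * riemannZeta 2) : ℂ) ≠ 0 := by
      rw [riemannZeta_two]; simp
    have : D2 γ = (1 / (2 * riemannZeta 2) : ℂ)⁻¹ • (E2 - E2 ∣[(2 : ℤ)] γ) := by
      rw [hE, sub_sub_cancel, smul_smul, inv_mul_cancel₀ h2, one_smul]
    rw [this]
    exact (E2_mdifferentiable.sub (E2_mdifferentiable.slash _ _)).const_smul _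
  have h1 := congrFun (normalizedDerivOfComplex_SL_slash (k := 2) E2_mdifferentiable (γ := γ)) z
  rw [hE, normalizedDerivOfComplex_sub _ _ E2_mdifferentiable (hDmd.const_smul _),
    normalizedDerivOfComplex_smul _ _ hDmd] at h1
  simp only [Pi.sub_apply, Pi.smul_apply, normalizedDerivOfComplex_D2, smul_eq_mul] at h1
  have hmul := congrFun (ModularForm.mul_slash_SL2 2 2 γ E2 E2) z
  rw [hE] at hmul
  simp only [Pi.sub_apply, Pi.smul_apply, smul_eq_mul, Pi.mul_apply] at hmul
  have hLHS : (serreDerivative 1 E2 ∣[(4 : ℤ)] γ) z =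
      (normalizedDerivOfComplex E2 ∣[(2 + 2 : ℤ)] γ) z - 12⁻¹ * ((E2 * E2) ∣[(2 + 2 : ℤ)] γ) z := by
    norm_num [ModularForm.SL_slash_apply, serreDerivative_apply]
    ring
  rw [hLHS, hmul, serreDerivative_apply]
  have hpi : (Real.pi : ℂ) ≠ 0 := by exact_mod_cast Real.pi_ne_zero
  rw [riemannZeta_two] at h1 ⊢
  have hD2 : D2 γ z = 2 * Real.pi * Complex.I * ((γ 1 0 : ℂ) / denom γ z) := by
    simp [D2, mul_div_assoc]
  rw [hD2] at h1 ⊢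
  set j : ℂ := (γ 1 0 : ℂ) / denom γ z
  have hI := Complex.I_sq
  have h3 : (normalizedDerivOfComplex E2 ∣[(2 + 2 : ℤ)] γ) z = normalizedDerivOfComplex E2 z -
      1 / (2 * (Real.pi ^ 2 / 6)) * -j ^ 2 + ((2 : ℤ) : ℂ) * (2 * Real.pi * Complex.I)⁻¹ * j *
      (E2 z - 1 / (2 * (Real.pi ^ 2 / 6)) * (2 * Real.pi * Complex.I * j)) := by
    linear_combination -h1
  rw [h3]
  have hIi : (Complex.I)⁻¹ = -Complex.I := Complex.inv_I
  simp only [mul_inv, hIi]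
  push_cast
  field_simp
  ring_nf
  simp only [hI]
  ring

/-- Below weight 12 a form is determined by its constant term, so each of Ramanujan's identities
needs only the comparison `hc`. -/
lemma serre_qExpansion {k : ℤ} (hk : k < 12) {F : ℍ → ℂ} {p : PowerSeries ℂ} {c r : ℂ}
    (hF : HasQExp F p) (hs : ∀ γ : SL(2, ℤ), serreDerivative r F ∣[k] γ = serreDerivative r F)
    (G : ModularForm 𝒮ℒ k) (hc : c * (qExpansion 1 G).coeff 0 = - r * 12⁻¹ * p.coeff 0) :
    theta ℂ p - (r * 12⁻¹) • (PowerSeries.map (Int.castRingHom ℂ) eisP * p) =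
      c • qExpansion 1 G := by
  have hS := HasQExp.serreDerivative hasQExp_E2 hF r
  obtain ⟨H, hH⟩ := exists_modularForm_coe_eq hS hs
  rw [← hS.qExpansion_eq, ← hH,
    ← ModularForm.qExpansion_smul one_pos one_mem_strictPeriods_SL c G, ← FunLike.coe_smul]
  refine qExpansion_eq_of_weight_lt_twelve hk H (c • G) ?_
  rw [FunLike.coe_smul, ModularForm.qExpansion_smul one_pos one_mem_strictPeriods_SL c G, hH,
    hS.qExpansion_eq, PowerSeries.coeff_smul, smul_eq_mul, hc]
  have h0 : (theta ℂ p).coeff 0 = 0 := by simp [coeff_theta]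
  rw [map_sub, h0, PowerSeries.coeff_smul, PowerSeries.coeff_zero_eq_constantCoeff_apply,
    map_mul, (constantCoeff_eis _).1]
  simp

lemma map_intCast_injective :
    Function.Injective (PowerSeries.map (Int.castRingHom ℂ)) :=
  PowerSeries.map_injective _ (RingHom.injective_int _)

/-- Ramanujan's differential equations. -/
theorem ramanujan_eisP : 12 * theta ℤ eisP = eisP ^ 2 - eisQ := by
  apply map_intCast_injective
  have := serre_qExpansion (k := 4) (c := -12⁻¹) (r := 1) (by norm_num) hasQExp_E2
    serreDerivative_E2_slash E₄ (by simp [qExpansion_E₄, constantCoeff_eis_int])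
  rw [qExpansion_E₄] at this
  simp only [map_mul, map_sub, map_pow, map_ofNat, map_theta]
  have h12 : (12 : PowerSeries ℂ) = PowerSeries.C 12 := (map_ofNat _ 12).symm
  rw [sub_eq_iff_eq_add] at this
  rw [this, h12, ← PowerSeries.smul_eq_C_mul, smul_add, smul_smul, smul_smul]
  norm_num
  ring

theorem ramanujan_eisQ : 3 * theta ℤ eisQ = eisP * eisQ - eisR := by
  apply map_intCast_injective
  have := serre_qExpansion (k := 6) (c := -3⁻¹) (r := (4 : ℤ)) (by norm_num)
    (hasQExp_coe E₄)
    (fun γ ↦ serreDerivative_slash_invariant (ModularFormClass.holo E₄) (slash_eq E₄ γ)) E₆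
    (by norm_num [qExpansion_E₄, qExpansion_E₆, constantCoeff_eis_int])
  rw [qExpansion_E₄, qExpansion_E₆] at this
  simp only [map_mul, map_sub, map_ofNat, map_theta]
  have h12 : (3 : PowerSeries ℂ) = PowerSeries.C 3 := (map_ofNat _ 3).symm
  rw [sub_eq_iff_eq_add] at this
  rw [this, h12, ← PowerSeries.smul_eq_C_mul, smul_add, smul_smul, smul_smul]
  norm_num
  ring

theorem ramanujan_eisR : 2 * theta ℤ eisR = eisP * eisR - eisQ ^ 2 := by
  apply map_intCast_injective
  have := serre_qExpansion (k := 8) (c := -2⁻¹) (r := (6 : ℤ)) (by norm_num)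
    (hasQExp_coe E₆)
    (fun γ ↦ serreDerivative_slash_invariant (ModularFormClass.holo E₆) (slash_eq E₆ γ))
    (E₄.mul E₄)
    (by norm_num [ModularForm.qExpansion_mul one_pos one_mem_strictPeriods_SL, qExpansion_E₄,
      qExpansion_E₆, constantCoeff_eis_int, constantCoeff_eis])
  rw [ModularForm.qExpansion_mul one_pos one_mem_strictPeriods_SL, qExpansion_E₄,
    qExpansion_E₆] at this
  simp only [map_mul, map_sub, map_pow, map_ofNat, map_theta]
  have h12 : (2 : PowerSeries ℂ) = PowerSeries.C 2 := (map_ofNat _ 2).symm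
  rw [sub_eq_iff_eq_add] at this
  rw [this, h12, ← PowerSeries.smul_eq_C_mul, smul_add, smul_smul, smul_smul]
  norm_num
  ring

end Ramanujan

end SimpleCongruence

namespace SimpleCongruence

/-! ### Reduction from ℤ_(ℓ) to 𝔽_ℓ -/

section Reduction

variable (ℓ : ℕ) [Fact ℓ.Prime]

lemma den_ne_zero (x : ZLoc ℓ) : (((x : ℚ).den : ℕ) : ZMod ℓ) ≠ 0 := by
  obtain ⟨a, b, hb, hx⟩ := x.2
  intro h
  rw [ZMod.natCast_eq_zero_iff] at h
  apply hb
  have h1 : (((a / b : ℚ).den : ℕ) : ℤ) ∣ b := by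
    rw [← Rat.divInt_eq_div]
    exact Rat.den_dvd a b
  rw [← hx] at h1
  exact (Int.natCast_dvd_natCast.mpr h).trans h1

/-- Reduction mod `ℓ` on `ℤ_(ℓ)`. -/
def red : ZLoc ℓ →+* ZMod ℓ where
  toFun x := ((x : ℚ) : ZMod ℓ)
  map_zero' := by simp
  map_one' := by simp
  map_add' x y := by
    exact_mod_cast Rat.cast_add_of_ne_zero (den_ne_zero ℓ x) (den_ne_zero ℓ y)
  map_mul' x y := by
    exact_mod_cast Rat.cast_mul_of_ne_zero (den_ne_zero ℓ x) (den_ne_zero ℓ y)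

variable {ℓ}

lemma red_apply (x : ZLoc ℓ) :
    red ℓ x = ((x : ℚ).num : ZMod ℓ) / (((x : ℚ).den : ℕ) : ZMod ℓ) := Rat.cast_def _

lemma red_surjective : Function.Surjective (red ℓ) := fun x ↦
  ⟨((x.val : ℕ) : ZLoc ℓ), by simp⟩

lemma inv_mem_ZLoc {b : ℤ} (hb : ¬ (ℓ : ℤ) ∣ b) : (b : ℚ)⁻¹ ∈ ZLoc ℓ :=
  ⟨1, b, hb, by simp⟩

lemma isUnit_of_red_ne_zero {x : ZLoc ℓ} (hx : red ℓ x ≠ 0) : IsUnit x := by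
  have h1 : ¬ (ℓ : ℤ) ∣ (x : ℚ).num := by
    intro h
    apply hx
    rw [red_apply, (ZMod.intCast_zmod_eq_zero_iff_dvd _ _).mpr h, zero_div]
  have h2 : (x : ℚ) ≠ 0 := by
    intro h
    apply hx
    rw [red_apply, h]
    simp
  refine IsUnit.of_mul_eq_one ⟨(x : ℚ)⁻¹, (x : ℚ).den, (x : ℚ).num, h1, ?_⟩ ?_
  · conv_lhs => rw [← Rat.num_div_den (x : ℚ)]
    rw [inv_div]
    norm_cast
  · ext
    simp [mul_inv_cancel₀ h2]

lemma red_eq_zero_iff {x : ZLoc ℓ} : red ℓ x = 0 ↔ (ℓ : ZLoc ℓ) ∣ x := by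
  constructor
  · intro h
    rw [red_apply, div_eq_zero_iff, or_iff_left (den_ne_zero ℓ x),
      ZMod.intCast_zmod_eq_zero_iff_dvd] at h
    obtain ⟨m, hm⟩ := h
    have hd : ¬ (ℓ : ℤ) ∣ ((x : ℚ).den : ℤ) := by
      have := den_ne_zero ℓ x
      rwa [Ne, ZMod.natCast_eq_zero_iff, ← Int.natCast_dvd_natCast] at this
    refine ⟨(m : ZLoc ℓ) * ⟨_, inv_mem_ZLoc hd⟩, ?_⟩
    ext
    conv_lhs => rw [← Rat.num_div_den (x : ℚ), hm]
    push_cast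
    ring
  · rintro ⟨y, rfl⟩
    simp

lemma congrMod_iff {f g : PowerSeries (ZLoc ℓ)} :
    CongrMod ℓ f g ↔ PowerSeries.map (red ℓ) f = PowerSeries.map (red ℓ) g := by
  simp only [CongrMod, ← red_eq_zero_iff, PowerSeries.ext_iff, PowerSeries.coeff_map, map_sub,
    sub_eq_zero]

end Reduction

/-! ### The spaces of ℓ-integral forms -/

section Spaces

open UpperHalfPlane EisensteinSeries ModularForm
open scoped ArithmeticFunction.sigma

variable {ℓ : ℕ} [Fact ℓ.Prime]

lemma algebraMap_ZLoc_injective : Function.Injective (algebraMap (ZLoc ℓ) ℂ) :=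
  (algebraMap ℚ ℂ).injective.comp Subtype.val_injective

lemma algebraMap_ZLoc_apply (x : ZLoc ℓ) : algebraMap (ZLoc ℓ) ℂ x = ((x : ℚ) : ℂ) := rfl

lemma map_ZLoc_injective : Function.Injective (PowerSeries.map (algebraMap (ZLoc ℓ) ℂ)) :=
  PowerSeries.map_injective _ algebraMap_ZLoc_injective

lemma map_map_intCast {A B : Type*} [CommRing A] [CommRing B] (g : A →+* B) (f : PowerSeries ℤ) :
    PowerSeries.map g (PowerSeries.map (Int.castRingHom A) f) =
      PowerSeries.map (Int.castRingHom B) f := by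
  ext n
  simp

lemma add_mem_M {k : ℤ} {f g : PowerSeries (ZLoc ℓ)} (hf : f ∈ M ℓ k) (hg : g ∈ M ℓ k) :
    f + g ∈ M ℓ k := by
  obtain ⟨F, hF⟩ := hf
  obtain ⟨G, hG⟩ := hg
  exact ⟨F + G, by
    rw [FunLike.coe_add, ModularForm.qExpansion_add one_pos one_mem_strictPeriods_SL, hF, hG,
      map_add]⟩

lemma sub_mem_M {k : ℤ} {f g : PowerSeries (ZLoc ℓ)} (hf : f ∈ M ℓ k) (hg : g ∈ M ℓ k) :
    f - g ∈ M ℓ k := by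
  obtain ⟨F, hF⟩ := hf
  obtain ⟨G, hG⟩ := hg
  exact ⟨F - G, by
    rw [FunLike.coe_sub, ModularForm.qExpansion_sub one_pos one_mem_strictPeriods_SL, hF, hG,
      map_sub]⟩

lemma mul_mem_M {k m : ℤ} {f g : PowerSeries (ZLoc ℓ)} (hf : f ∈ M ℓ k) (hg : g ∈ M ℓ m) :
    f * g ∈ M ℓ (k + m) := by
  obtain ⟨F, hF⟩ := hf
  obtain ⟨G, hG⟩ := hg
  exact ⟨F.mul G, by
    rw [ModularForm.qExpansion_mul one_pos one_mem_strictPeriods_SL, hF, hG, map_mul]⟩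

lemma one_mem_M : (1 : PowerSeries (ZLoc ℓ)) ∈ M ℓ 0 :=
  ⟨1, by rw [ModularForm.qExpansion_one, map_one]⟩

lemma zero_mem_M (k : ℤ) : (0 : PowerSeries (ZLoc ℓ)) ∈ M ℓ k :=
  ⟨0, by rw [map_zero]; exact qExpansion_zero 1⟩

lemma pow_mem_M {k : ℤ} {f : PowerSeries (ZLoc ℓ)} (hf : f ∈ M ℓ k) (n : ℕ) :
    f ^ n ∈ M ℓ (n * k) := by
  induction n with
  | zero => simpa using one_mem_M
  | succ n ih =>
    rw [pow_succ, show ((n + 1 : ℕ) : ℤ) * k = n * k + k by push_cast; ring]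
    exact mul_mem_M ih hf

lemma C_mul_mem_M {k : ℤ} (a : ZLoc ℓ) {f : PowerSeries (ZLoc ℓ)} (hf : f ∈ M ℓ k) :
    PowerSeries.C a * f ∈ M ℓ k := by
  obtain ⟨F, hF⟩ := hf
  exact ⟨(algebraMap (ZLoc ℓ) ℂ a) • F, by
    rw [FunLike.coe_smul, ModularForm.qExpansion_smul one_pos one_mem_strictPeriods_SL, hF,
      map_mul, PowerSeries.map_C, PowerSeries.smul_eq_C_mul]⟩

lemma eisQ_mem_M : PowerSeries.map (Int.castRingHom (ZLoc ℓ)) eisQ ∈ M ℓ 4 :=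
  ⟨E₄, by rw [qExpansion_E₄, map_map_intCast]⟩

lemma eisR_mem_M : PowerSeries.map (Int.castRingHom (ZLoc ℓ)) eisR ∈ M ℓ 6 :=
  ⟨E₆, by rw [qExpansion_E₆, map_map_intCast]⟩

lemma eq_zero_of_mem_M_of_neg {k : ℤ} (hk : k < 0) {f : PowerSeries (ZLoc ℓ)}
    (hf : f ∈ M ℓ k) : f = 0 := by
  obtain ⟨F, hF⟩ := hf
  apply map_ZLoc_injective
  rw [← hF, ModularFormClass.levelOne_neg_weight_eq_zero hk F, qExpansion_zero, map_zero]

lemma eq_zero_of_mem_M_of_odd {k : ℤ} (hk : Odd k) {f : PowerSeries (ZLoc ℓ)}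
    (hf : f ∈ M ℓ k) : f = 0 := by
  obtain ⟨F, hF⟩ := hf
  apply map_ZLoc_injective
  rw [← hF, ModularForm.levelOne_odd_weight_eq_zero hk F, map_zero]
  exact qExpansion_zero 1

lemma eq_zero_of_mem_M_two {f : PowerSeries (ZLoc ℓ)} (hf : f ∈ M ℓ 2) : f = 0 := by
  obtain ⟨F, hF⟩ := hf
  apply map_ZLoc_injective
  rw [← hF, rank_zero_iff_forall_zero.mp levelOne_weight_two_rank_zero F, map_zero]
  exact qExpansion_zero 1

lemma C_1728_mul_qExpansion_discriminant :
    PowerSeries.C 1728 * qExpansion 1 discriminant =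
      PowerSeries.map (Int.castRingHom ℂ) (eisQ ^ 3 - eisR ^ 2) := by
  have h1 : (((1728 : ℂ) • CuspForm.discriminant : CuspForm 𝒮ℒ 12) : ℍ → ℂ) =
      ((ModularForm.mcast (by decide) (E₄.pow 3) - ModularForm.mcast (by decide) (E₆.pow 2) :
        ModularForm 𝒮ℒ 12) : ℍ → ℂ) := by
    ext z
    simp only [FunLike.coe_smul, FunLike.coe_sub, Pi.smul_apply, Pi.sub_apply, coe_mcast, coe_pow,
      Pi.pow_apply, smul_eq_mul, CuspForm.coe_discriminant, discriminant_eq_E₄_cube_sub_E₆_sq]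
    ring
  have h2 := congrArg (qExpansion 1) h1
  rw [FunLike.coe_smul, ModularForm.qExpansion_smul one_pos one_mem_strictPeriods_SL,
    FunLike.coe_sub, ModularForm.qExpansion_sub one_pos one_mem_strictPeriods_SL] at h2
  simp only [coe_mcast, ModularForm.qExpansion_pow one_pos one_mem_strictPeriods_SL,
    qExpansion_E₄, qExpansion_E₆, CuspForm.coe_discriminant] at h2
  rw [← PowerSeries.smul_eq_C_mul, h2]
  simp

lemma intCast_ne_zero_of_five_le (hℓ : 5 ≤ ℓ) {n : ℤ} {a b : ℕ} (hn : n = 2 ^ a * 3 ^ b) :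
    (n : ZMod ℓ) ≠ 0 := by
  have hp : ℓ.Prime := Fact.out
  rw [Ne, ZMod.intCast_zmod_eq_zero_iff_dvd, hn]
  intro h
  have h' : ℓ ∣ 2 ^ a * 3 ^ b := by exact_mod_cast h
  rcases (hp.dvd_mul).mp h' with h | h
  · have := Nat.le_of_dvd (by norm_num) (hp.dvd_of_dvd_pow h); omega
  · have := Nat.le_of_dvd (by norm_num) (hp.dvd_of_dvd_pow h); omega

/-- Since 1728 is a unit, Δ is ℓ-integral, and Δ = q · unit because its leading coefficient is 1.
Hence dividing a form without constant term by Δ keeps its coefficients in ℤ_(ℓ). -/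
lemma exists_discriminant_mul (hℓ : 5 ≤ ℓ) : ∃ d : ZLoc ℓ, 1728 * d = 1 ∧
    ∀ (k : ℤ) (f : PowerSeries (ZLoc ℓ)), f ∈ M ℓ k → f.coeff 0 = 0 → ∃ g ∈ M ℓ (k - 12),
      f = PowerSeries.C d *
        PowerSeries.map (Int.castRingHom (ZLoc ℓ)) (eisQ ^ 3 - eisR ^ 2) * g := by
  have hu : IsUnit (1728 : ZLoc ℓ) := by
    apply isUnit_of_red_ne_zero
    rw [map_ofNat]
    exact_mod_cast intCast_ne_zero_of_five_le hℓ (n := 1728) (a := 6) (b := 3) (by norm_num)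
  obtain ⟨d, hd⟩ := hu.exists_right_inv
  refine ⟨d, hd, fun k f hf hf0 ↦ ?_⟩
  set Δ' := PowerSeries.C d *
    PowerSeries.map (Int.castRingHom (ZLoc ℓ)) (eisQ ^ 3 - eisR ^ 2) with hΔ'
  have hmap : PowerSeries.map (algebraMap (ZLoc ℓ) ℂ) Δ' = qExpansion 1 discriminant := by
    rw [hΔ', map_mul, map_map_intCast, ← C_1728_mul_qExpansion_discriminant, PowerSeries.map_C,
      ← mul_assoc, ← map_mul, mul_comm, ← map_ofNat (algebraMap (ZLoc ℓ) ℂ) 1728, mul_comm,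
      ← map_mul, mul_comm d, hd]
    simp
  have hc0 : Δ'.coeff 0 = 0 := by
    simp [hΔ', constantCoeff_eis]
  have hc1 : Δ'.coeff 1 = 1 := by
    apply algebraMap_ZLoc_injective
    rw [← PowerSeries.coeff_map, hmap, discriminant_qExpansion_coeff_one, map_one]
  have hX : ∀ p : PowerSeries (ZLoc ℓ), p.coeff 0 = 0 → ∃ r, p = PowerSeries.X * r := fun p hp ↦
    PowerSeries.X_dvd_iff.mpr (by simpa using hp)
  obtain ⟨u, hu⟩ := hX Δ' hc0
  obtain ⟨f', hf'⟩ := hX f hf0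
  have hu1 : IsUnit u := by
    rw [PowerSeries.isUnit_iff_constantCoeff]
    rw [hu, PowerSeries.coeff_succ_X_mul 0] at hc1
    rw [← PowerSeries.coeff_zero_eq_constantCoeff_apply, hc1]
    exact isUnit_one
  obtain ⟨v, hv⟩ := hu1.exists_right_inv
  have hfg : f = Δ' * (f' * v) := by
    rw [hf', hu]
    linear_combination (-PowerSeries.X * f') * hv
  refine ⟨f' * v, ?_, hfg⟩
  obtain ⟨F, hF⟩ := hf
  have hcusp : (qExpansion 1 F).coeff 0 = 0 := by
    rw [hF, PowerSeries.coeff_map, hf0, map_zero]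
  refine ⟨CuspForm.discriminantEquiv (toCuspForm F hcusp), ?_⟩
  have h1 := qExpansion_eq_qExpansion_discriminant_mul F hcusp
  rw [hF, hfg, map_mul, hmap] at h1
  refine (mul_left_cancel₀ ?_ h1).symm
  intro h0
  have := discriminant_qExpansion_coeff_one
  rw [h0] at this
  simp at this

end Spaces

end SimpleCongruence

namespace SimpleCongruence

/-! ### Forms mod ℓ as polynomials in E₄ and E₆ -/

section PolynomialModel

open MvPolynomial

variable (ℓ : ℕ) [Fact ℓ.Prime]

/-- The reduction mod `ℓ` of an integral power series. -/
noncomputable abbrev bar (f : PowerSeries ℤ) : PowerSeries (ZMod ℓ) :=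
  PowerSeries.map (Int.castRingHom (ZMod ℓ)) f

/-- Evaluation of polynomials over `𝔽_ℓ` at the reductions of `E₄` and `E₆`. -/
noncomputable def phi : MvPolynomial (Fin 2) (ZMod ℓ) →ₐ[ZMod ℓ] PowerSeries (ZMod ℓ) :=
  aeval ![bar ℓ eisQ, bar ℓ eisR]

/-- The weights of `E₄` and `E₆`. -/
def wt : Fin 2 → ℕ := ![4, 6]

variable {ℓ}

@[simp] lemma phi_X_zero : phi ℓ (X 0) = bar ℓ eisQ := by simp [phi]

@[simp] lemma phi_X_one : phi ℓ (X 1) = bar ℓ eisR := by simp [phi]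

@[simp] lemma phi_C (a : ZMod ℓ) : phi ℓ (C a) = PowerSeries.C a := by
  simp [phi]

lemma weight_wt (d : Fin 2 →₀ ℕ) : Finsupp.weight wt d = 4 * d 0 + 6 * d 1 := by
  simp [Finsupp.weight_apply, Finsupp.sum_fintype, wt, mul_comm]

lemma homogeneous_X_zero : IsWeightedHomogeneous wt (X 0 : MvPolynomial (Fin 2) (ZMod ℓ)) 4 :=
  isWeightedHomogeneous_X _ _ 0

lemma homogeneous_X_one : IsWeightedHomogeneous wt (X 1 : MvPolynomial (Fin 2) (ZMod ℓ)) 6 :=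
  isWeightedHomogeneous_X _ _ 1

lemma exists_mem_M_of_homogeneous {p : MvPolynomial (Fin 2) (ZMod ℓ)} {n : ℕ}
    (hp : IsWeightedHomogeneous wt p n) :
    ∃ f ∈ M ℓ n, PowerSeries.map (red ℓ) f = phi ℓ p := by
  suffices h : ∀ s : Finset (Fin 2 →₀ ℕ), (∀ d ∈ s, Finsupp.weight wt d = n) →
      ∃ f ∈ M ℓ n, PowerSeries.map (red ℓ) f = phi ℓ (∑ d ∈ s, monomial d (p.coeff d)) by
    have := h p.support fun d hd ↦ hp (mem_support_iff.mp hd)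
    rwa [support_sum_monomial_coeff] at this
  intro s
  induction s using Finset.induction_on with
  | empty => exact fun _ ↦ ⟨0, zero_mem_M _, by simp⟩
  | insert d s hd ih =>
    intro hs
    obtain ⟨f, hf, hfp⟩ := ih fun e he ↦ hs e (Finset.mem_insert_of_mem he)
    obtain ⟨a, ha⟩ := red_surjective (ℓ := ℓ) (p.coeff d)
    have hw := hs d (Finset.mem_insert_self _ _)
    rw [weight_wt] at hw
    refine ⟨PowerSeries.C a * (PowerSeries.map (Int.castRingHom (ZLoc ℓ)) eisQ ^ d 0 *
      PowerSeries.map (Int.castRingHom (ZLoc ℓ)) eisR ^ d 1) + f, add_mem_M ?_ hf, ?_⟩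
    · refine C_mul_mem_M a ?_
      have := mul_mem_M (pow_mem_M (eisQ_mem_M (ℓ := ℓ)) (d 0))
        (pow_mem_M (eisR_mem_M (ℓ := ℓ)) (d 1))
      rw [← hw]
      convert this using 1
      push_cast
      ring_nf
    · rw [Finset.sum_insert hd, map_add, map_add, hfp, monomial_eq]
      simp only [map_mul, map_pow, map_map_intCast, PowerSeries.map_C, ha, phi_C]
      simp [Finsupp.prod_fintype]

/-- Induction on the weight: subtract a multiple of E₄^a E₆^b to kill the constant term, then divide
by Δ, which lowers the weight by 12. -/
lemma exists_homogeneous_of_mem_M (hℓ : 5 ≤ ℓ) (n : ℕ) (f : PowerSeries (ZLoc ℓ))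
    (hf : f ∈ M ℓ n) : ∃ p : MvPolynomial (Fin 2) (ZMod ℓ), IsWeightedHomogeneous wt p n ∧
      phi ℓ p = PowerSeries.map (red ℓ) f := by
  obtain ⟨d, hd, hdiv⟩ := exists_discriminant_mul hℓ
  induction n using Nat.strong_induction_on generalizing f with | _ n ih =>
  have hzero : f = 0 → ∃ p : MvPolynomial (Fin 2) (ZMod ℓ), IsWeightedHomogeneous wt p n ∧
      phi ℓ p = PowerSeries.map (red ℓ) f := fun h ↦
    ⟨0, isWeightedHomogeneous_zero _ _ _, by simp [h]⟩
  rcases Nat.even_or_odd n with hn | hn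
  swap
  · exact hzero (eq_zero_of_mem_M_of_odd (by exact_mod_cast hn) hf)
  by_cases hn2 : n = 2
  · subst hn2
    exact hzero (eq_zero_of_mem_M_two hf)
  obtain ⟨a, b, hab⟩ : ∃ a b, 4 * a + 6 * b = n := by
    obtain ⟨m, hm⟩ := hn
    rcases Nat.even_or_odd m with ⟨r, hr⟩ | ⟨r, hr⟩
    · exact ⟨r, 0, by omega⟩
    -- Here n = 4r + 2, and n ≠ 2 makes r positive.
    · exact ⟨r - 1, 1, by omega⟩
  set c := f.coeff 0
  set g := PowerSeries.C c * (PowerSeries.map (Int.castRingHom (ZLoc ℓ)) eisQ ^ a *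
      PowerSeries.map (Int.castRingHom (ZLoc ℓ)) eisR ^ b) with hg
  have hgM : g ∈ M ℓ n := by
    refine C_mul_mem_M _ ?_
    have := mul_mem_M (pow_mem_M (eisQ_mem_M (ℓ := ℓ)) a) (pow_mem_M (eisR_mem_M (ℓ := ℓ)) b)
    rw [← hab]
    convert this using 1
    push_cast
    ring_nf
  have hg0 : (f - g).coeff 0 = 0 := by
    rw [map_sub, hg]
    simp [constantCoeff_eis, c]
  obtain ⟨h, hh, hfgh⟩ := hdiv n (f - g) (sub_mem_M hf hgM) hg0
  obtain ⟨p, hp, hpe⟩ : ∃ p : MvPolynomial (Fin 2) (ZMod ℓ),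
      IsWeightedHomogeneous wt ((X 0 ^ 3 - X 1 ^ 2) * p) n ∧
      phi ℓ p = PowerSeries.map (red ℓ) h := by
    by_cases h12 : n < 12
    · rw [eq_zero_of_mem_M_of_neg (by omega) hh]
      exact ⟨0, by simpa using isWeightedHomogeneous_zero _ _ _, by simp⟩
    · obtain ⟨p, hp, hpe⟩ := ih (n - 12) (by omega) h
        (by rwa [show ((n - 12 : ℕ) : ℤ) = n - 12 by omega])
      refine ⟨p, ?_, hpe⟩
      have := (((homogeneous_X_zero (ℓ := ℓ)).pow 3).sub
        ((homogeneous_X_one (ℓ := ℓ)).pow 2)).mul hp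
      rwa [show 3 • 4 + (n - 12) = n by simp; omega] at this
  refine ⟨C (red ℓ c) * (X 0 ^ a * X 1 ^ b) + C (red ℓ d) * ((X 0 ^ 3 - X 1 ^ 2) * p),
    (IsWeightedHomogeneous.C_mul ?_ _).add (hp.C_mul _), ?_⟩
  · have := ((homogeneous_X_zero (ℓ := ℓ)).pow a).mul ((homogeneous_X_one (ℓ := ℓ)).pow b)
    rwa [show a • 4 + b • 6 = n by simp; omega] at this
  · rw [← sub_add_cancel f g, hfgh, hg]
    simp only [map_add, map_mul, map_sub, map_pow, map_map_intCast, PowerSeries.map_C, phi_C,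
      phi_X_zero, phi_X_one, hpe]
    ring

/-! ### The Hasse invariant from E_(ℓ-1) -/

section Hasse

open UpperHalfPlane EisensteinSeries ModularForm
open scoped ArithmeticFunction.sigma

/-- The left side is the factor of the nonconstant coefficients of E_(ℓ-1). By von Staudt–Clausen ℓ
B_(ℓ-1) ≡ -1 mod ℓ, a unit, so dividing by the Bernoulli number contributes a factor ℓ. -/
lemma exists_two_mul_div_bernoulli (hℓ : 5 ≤ ℓ) :
    ∃ γ : ZLoc ℓ, -(2 * ((ℓ - 1 : ℕ) : ℚ) / bernoulli (ℓ - 1)) = ℓ * (γ : ℚ) := by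
  have hp : ℓ.Prime := Fact.out
  obtain ⟨m, hm⟩ : ∃ m, ℓ - 1 = 2 * m := by
    obtain ⟨m, hm⟩ := hp.odd_of_ne_two (by omega)
    exact ⟨m, by omega⟩
  obtain ⟨n, hn⟩ := Bernoulli.vonStaudt_clausen m
  rw [← hm, show ℓ - 1 + 2 = ℓ + 1 by omega] at hn
  set s := (Finset.range (ℓ + 1)).filter fun p ↦ p.Prime ∧ (p - 1) ∣ ℓ - 1
  have hℓs : ℓ ∈ s := by simp [s, hp]
  rw [← Finset.add_sum_erase _ _ hℓs] at hn
  have hsum : ∑ p ∈ s.erase ℓ, (1 : ℚ) / p ∈ ZLoc ℓ := by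
    refine sum_mem fun p hps ↦ ?_
    rw [one_div]
    refine inv_mem_ZLoc (b := p) ?_
    simp only [s, Finset.mem_erase, Finset.mem_filter] at hps
    rw [Int.natCast_dvd_natCast, Nat.prime_dvd_prime_iff_eq hp hps.2.2.1]
    exact Ne.symm hps.1
  set t : ZLoc ℓ := ⟨_, hsum⟩
  have hu : IsUnit ((ℓ : ZLoc ℓ) * (n - t) - 1) := by
    apply isUnit_of_red_ne_zero
    simp
  obtain ⟨v, hv⟩ := hu.exists_right_inv
  have hℓ0 : (ℓ : ℚ) ≠ 0 := by exact_mod_cast hp.ne_zero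
  have hv' : ((ℓ : ℚ) * (n - (t : ℚ)) - 1) * (v : ℚ) = 1 := by
    have := congrArg (Subtype.val) hv
    push_cast at this
    exact this
  have hB : (ℓ : ℚ) * bernoulli (ℓ - 1) = ℓ * (n - (t : ℚ)) - 1 := by
    have : (n : ℚ) = bernoulli (ℓ - 1) + (1 / ℓ + (t : ℚ)) := hn
    rw [this]
    field_simp
    ring
  refine ⟨-(2 * ((ℓ - 1 : ℕ) : ZLoc ℓ) * v), ?_⟩
  rw [← hB] at hv'
  have hB0 : bernoulli (ℓ - 1) ≠ 0 := by
    rintro h0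
    simp [h0] at hv'
  have h2 : ((2 : ZLoc ℓ) : ℚ) = 2 := rfl
  push_cast
  rw [h2]
  field_simp
  linear_combination ((ℓ - 1 : ℕ) : ℚ) * hv'

/-- There is a form of weight `ℓ - 1` congruent to `1` mod `ℓ`. -/
lemma exists_phi_eq_one (hℓ : 5 ≤ ℓ) : ∃ A : MvPolynomial (Fin 2) (ZMod ℓ),
    IsWeightedHomogeneous wt A (ℓ - 1) ∧ phi ℓ A = 1 := by
  have hp : ℓ.Prime := Fact.out
  obtain ⟨γ, hγ⟩ := exists_two_mul_div_bernoulli hℓ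
  have heven : Even (ℓ - 1) := hp.even_sub_one (by omega)
  set f : PowerSeries (ZLoc ℓ) := .mk fun m ↦
    if m = 0 then 1 else ℓ * γ * σ (ℓ - 1 - 1) m
  have hf : f ∈ M ℓ ((ℓ - 1 : ℕ) : ℤ) := by
    refine ⟨E (by omega : 3 ≤ ℓ - 1), ?_⟩
    ext m
    rw [E_qExpansion_coeff _ heven, PowerSeries.coeff_map, PowerSeries.coeff_mk,
      algebraMap_ZLoc_apply]
    split_ifs
    · simp
    · have := congrArg (Rat.cast : ℚ → ℂ) hγ
      push_cast at this ⊢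
      rw [this]
  obtain ⟨A, hA, hAe⟩ := exists_homogeneous_of_mem_M hℓ _ f hf
  refine ⟨A, hA, ?_⟩
  rw [hAe]
  ext m
  rw [PowerSeries.coeff_map, PowerSeries.coeff_mk, PowerSeries.coeff_one]
  split_ifs <;> simp

end Hasse

end PolynomialModel

end SimpleCongruence

namespace SimpleCongruence

/-! ### Weighted homogeneity through an auxiliary variable -/

section Weights

open MvPolynomial

variable {ℓ : ℕ} [Fact ℓ.Prime]

/-- Substitution of `T⁴ X₀` and `T⁶ X₁` for `X₀` and `X₁`: the coefficient of `Tⁿ` is the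
component of weight `n`. -/
noncomputable def tau : MvPolynomial (Fin 2) (ZMod ℓ) →ₐ[ZMod ℓ]
    Polynomial (MvPolynomial (Fin 2) (ZMod ℓ)) :=
  aeval fun i ↦ Polynomial.monomial (wt i) (X i)

lemma tau_monomial (d : Fin 2 →₀ ℕ) (c : ZMod ℓ) :
    tau (monomial d c) = Polynomial.monomial (Finsupp.weight wt d) (monomial d c) := by
  have h : ∀ a : ZMod ℓ, algebraMap (ZMod ℓ) (Polynomial (MvPolynomial (Fin 2) (ZMod ℓ))) a =
    Polynomial.monomial 0 (C a) := fun a ↦ rfl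
  rw [tau, aeval_monomial, h]
  simp only [Finsupp.prod_fintype, pow_zero, implies_true, Fin.prod_univ_two,
    Polynomial.monomial_pow, weight_wt, monomial_eq]
  simp [wt, Finsupp.prod_fintype, Polynomial.monomial_mul_monomial, Polynomial.C_mul_monomial]

lemma coeff_tau (f : MvPolynomial (Fin 2) (ZMod ℓ)) (n : ℕ) :
    (tau f).coeff n = weightedHomogeneousComponent wt n f := by
  classical
  induction f using MvPolynomial.induction_on' with
  | monomial d c =>
    rw [tau_monomial, Polynomial.coeff_monomial]
    ext e
    rw [coeff_weightedHomogeneousComponent]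
    split_ifs with h1 h2 h2
    · rfl
    · rw [coeff_monomial, if_neg]
      rintro rfl
      exact h2 h1
    · rw [coeff_monomial, if_neg, coeff_zero]
      rintro rfl
      exact h1 h2
    · rfl
  | add p q hp hq => rw [map_add, Polynomial.coeff_add, hp, hq, map_add]

lemma eval_one_tau (f : MvPolynomial (Fin 2) (ZMod ℓ)) : (tau f).eval 1 = f := by
  induction f using MvPolynomial.induction_on' with
  | monomial d c => rw [tau_monomial, Polynomial.eval_monomial, one_pow, mul_one]
  | add p q hp hq => rw [map_add, Polynomial.eval_add, hp, hq]

lemma homogeneous_iff_tau {f : MvPolynomial (Fin 2) (ZMod ℓ)} {n : ℕ} :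
    IsWeightedHomogeneous wt f n ↔ tau f = Polynomial.monomial n f := by
  constructor
  · intro h
    ext1 m
    rw [coeff_tau, Polynomial.coeff_monomial]
    split_ifs with hm
    · subst hm
      exact h.weightedHomogeneousComponent_same
    · exact h.weightedHomogeneousComponent_ne m (Ne.symm hm)
  · intro h
    have := coeff_tau f n
    rw [h, Polynomial.coeff_monomial, if_pos rfl] at this
    rw [this]
    exact weightedHomogeneousComponent_isWeightedHomogeneous n f

lemma homogeneous_of_tau_eq {f g : MvPolynomial (Fin 2) (ZMod ℓ)} {n : ℕ}
    (h : tau f = Polynomial.monomial n g) : IsWeightedHomogeneous wt f n := by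
  rw [homogeneous_iff_tau, h]
  have := eval_one_tau f
  rw [h, Polynomial.eval_monomial, one_pow, mul_one] at this
  rw [this]

/-- The factors of a nonzero homogeneous polynomial are homogeneous. -/
lemma homogeneous_of_mul {f g : MvPolynomial (Fin 2) (ZMod ℓ)} {n : ℕ} (h0 : f * g ≠ 0)
    (h : IsWeightedHomogeneous wt (f * g) n) :
    ∃ a b, IsWeightedHomogeneous wt f a ∧ IsWeightedHomogeneous wt g b ∧ a + b = n := by
  have hinj : ∀ p : MvPolynomial (Fin 2) (ZMod ℓ), p ≠ 0 → tau p ≠ 0 := by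
    intro p hp h
    apply hp
    rw [← eval_one_tau p, h, Polynomial.eval_zero]
  have hf := hinj f (left_ne_zero_of_mul h0)
  have hg := hinj g (right_ne_zero_of_mul h0)
  rw [homogeneous_iff_tau, map_mul] at h
  -- Both the top and the bottom degree in T are additive. They agree for the product, so they agree
  -- for each factor.
  have h1 := Polynomial.natDegree_mul hf hg
  have h2 := Polynomial.natTrailingDegree_mul hf hg
  rw [h, Polynomial.natDegree_monomial_eq _ h0] at h1
  rw [h, Polynomial.natTrailingDegree_monomial h0] at h2
  have h3 := Polynomial.natTrailingDegree_le_natDegree (tau f)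
  have h4 := Polynomial.natTrailingDegree_le_natDegree (tau g)
  have key : ∀ p : MvPolynomial (Fin 2) (ZMod ℓ),
      (tau p).natTrailingDegree = (tau p).natDegree →
      IsWeightedHomogeneous wt p (tau p).natDegree := by
    intro p hp
    apply homogeneous_of_tau_eq (g := (tau p).leadingCoeff)
    ext1 m
    rw [Polynomial.coeff_monomial]
    split_ifs with hm
    · rw [← hm]; rfl
    · rcases lt_or_gt_of_ne hm with h | h
      · exact Polynomial.coeff_eq_zero_of_natDegree_lt h
      · exact Polynomial.coeff_eq_zero_of_lt_natTrailingDegree (by omega)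
  exact ⟨_, _, key f (by omega), key g (by omega), h1.symm⟩

lemma homogeneous_leadingCoeff_tau (f : MvPolynomial (Fin 2) (ZMod ℓ)) :
    IsWeightedHomogeneous wt (tau f).leadingCoeff (tau f).natDegree := by
  rw [Polynomial.leadingCoeff, coeff_tau]
  exact weightedHomogeneousComponent_isWeightedHomogeneous _ f

lemma eq_zero_of_homogeneous_two {f : MvPolynomial (Fin 2) (ZMod ℓ)}
    (hf : IsWeightedHomogeneous wt f 2) : f = 0 :=
  hf.eq_zero_of_no_monomials fun d ↦ by rw [weight_wt]; omega

lemma not_isUnit_of_homogeneous {f : MvPolynomial (Fin 2) (ZMod ℓ)} {n : ℕ} (hn : 0 < n)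
    (hf : IsWeightedHomogeneous wt f n) : ¬ IsUnit f := by
  intro hu
  obtain ⟨g, hg⟩ := hu.exists_right_inv
  obtain ⟨a, b, ha, -, hab⟩ := homogeneous_of_mul (hg ▸ one_ne_zero) (n := 0)
    (by rw [hg]; exact isWeightedHomogeneous_one _ _)
  have := ha.inj_right hu.ne_zero hf
  omega

lemma isUnit_of_homogeneous_zero {f : MvPolynomial (Fin 2) (ZMod ℓ)} (h0 : f ≠ 0)
    (hf : IsWeightedHomogeneous wt f 0) : IsUnit f := by
  have := hf.eq_monomial_of_unique_weight (d₀ := 0) fun d hd ↦ by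
    rw [weight_wt] at hd
    ext i
    fin_cases i <;> simp <;> omega
  rw [this] at h0 ⊢
  have hc : coeff 0 f ≠ 0 := fun h ↦ h0 (by rw [h, map_zero])
  exact (isUnit_iff_ne_zero.mpr hc).map C

/-- The automorphism multiplying the component of weight `n` by `tⁿ`. -/
noncomputable def sigma (t : ZMod ℓ) :
    MvPolynomial (Fin 2) (ZMod ℓ) →ₐ[ZMod ℓ] MvPolynomial (Fin 2) (ZMod ℓ) :=
  (Polynomial.aeval (R := MvPolynomial (Fin 2) (ZMod ℓ)) (C t)).restrictScalars (ZMod ℓ)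
    |>.comp tau

lemma sigma_apply (t : ZMod ℓ) (f : MvPolynomial (Fin 2) (ZMod ℓ)) :
    sigma t f = (tau f).eval (C t) := by
  simp [sigma]

lemma sigma_of_homogeneous (t : ZMod ℓ) {f : MvPolynomial (Fin 2) (ZMod ℓ)} {n : ℕ}
    (hf : IsWeightedHomogeneous wt f n) : sigma t f = C (t ^ n) * f := by
  rw [sigma_apply, homogeneous_iff_tau.mp hf, Polynomial.eval_monomial, mul_comm, map_pow]

/-- Rescaling by t multiplies the top-weight component by a power of t. -/
lemma leadingCoeff_tau_sigma {t : ZMod ℓ} (ht : t ≠ 0) (f : MvPolynomial (Fin 2) (ZMod ℓ)) :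
    (tau f).leadingCoeff ∣ (tau (sigma t f)).leadingCoeff := by
  have h : tau (sigma t f) = (tau f).comp (Polynomial.C (C t) * Polynomial.X) := by
    induction f using MvPolynomial.induction_on' with
    | monomial d c =>
      rw [sigma_of_homogeneous t (isWeightedHomogeneous_monomial wt d c rfl), C_mul_monomial,
        tau_monomial, tau_monomial, Polynomial.monomial_comp, mul_pow, ← map_pow, ← mul_assoc,
        ← map_mul, Polynomial.C_mul_X_pow_eq_monomial, ← map_pow, mul_comm (monomial d c),
        C_mul_monomial]
    | add p q hp hq => rw [map_add, map_add, map_add, Polynomial.add_comp, hp, hq]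
  have hC : C t ≠ (0 : MvPolynomial (Fin 2) (ZMod ℓ)) := by simpa using ht
  rw [h, Polynomial.leadingCoeff_comp]
  · exact Dvd.intro _ rfl
  · rw [Polynomial.natDegree_C_mul_X _ hC]
    exact one_ne_zero

end Weights

/-! ### The kernel of reduction -/

section Kernel

open MvPolynomial

variable {ℓ : ℕ} [Fact ℓ.Prime]

/-- The kernel of `phi` has height at most one. -/
lemma dvd_of_phi_eq_zero (hℓ : 5 ≤ ℓ) {p h : MvPolynomial (Fin 2) (ZMod ℓ)} (hp : Prime p)
    (hp0 : phi ℓ p = 0) (hh : phi ℓ h = 0) : p ∣ h := by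
  by_contra hdvd
  -- If p ∤ h, then 0 < (p) < ker φ < ker(constant term ∘ φ) is a chain of primes of length 3 in a
  -- ring of dimension 2. The last inclusion is strict because E₄³ - E₆² = 1728 q + ⋯.
  let I₁ : Ideal (MvPolynomial (Fin 2) (ZMod ℓ)) := Ideal.span {p}
  let I₂ : Ideal (MvPolynomial (Fin 2) (ZMod ℓ)) := RingHom.ker (phi ℓ)
  let I₃ : Ideal (MvPolynomial (Fin 2) (ZMod ℓ)) :=
    RingHom.ker ((PowerSeries.constantCoeff (R := ZMod ℓ)).comp (phi ℓ).toRingHom)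
  have i₁ : I₁.IsPrime := (Ideal.span_singleton_prime hp.ne_zero).mpr hp
  have i₂ : I₂.IsPrime := RingHom.ker_isPrime _
  have i₃ : I₃.IsPrime := RingHom.ker_isPrime _
  have h01 : ⊥ < I₁ := by
    rw [bot_lt_iff_ne_bot]
    simpa [I₁] using hp.ne_zero
  have h12 : I₁ < I₂ := by
    refine lt_of_le_of_ne ?_ ?_
    · rw [Ideal.span_singleton_le_iff_mem]
      exact hp0
    · intro h12
      have : h ∈ I₁ := by rw [h12]; exact hh
      exact hdvd (Ideal.mem_span_singleton.mp this)
  have h23 : I₂ < I₃ := by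
    refine lt_of_le_of_ne ?_ ?_
    · intro x hx
      have hx' : phi ℓ x = 0 := hx
      simp [I₃, RingHom.mem_ker, hx']
    · intro h23
      have : (X 0 ^ 3 - X 1 ^ 2 : MvPolynomial (Fin 2) (ZMod ℓ)) ∈ I₃ := by
        simp [I₃, RingHom.mem_ker, constantCoeff_eis]
      rw [← h23] at this
      have h0 : phi ℓ (X 0 ^ 3 - X 1 ^ 2) = 0 := this
      have h1 := congrArg (PowerSeries.coeff 1) h0
      have h2 : (eisQ ^ 3 - eisR ^ 2).coeff 1 = 1728 := by
        simp [pow_succ, PowerSeries.coeff_mul, Finset.Nat.antidiagonal_succ,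
          constantCoeff_eis_int]
        simp [eisQ, eisR]
      simp only [map_sub, map_pow, phi_X_zero, phi_X_one] at h1
      rw [← map_sub, ← map_pow, ← map_pow, ← map_sub, PowerSeries.coeff_map, h2] at h1
      exact intCast_ne_zero_of_five_le hℓ (n := 1728) (a := 6) (b := 3) (by norm_num)
        (by simpa using h1)
  have e1 := Ideal.height_add_one_le_of_lt_of_isPrime h01
  have e2 := Ideal.height_add_one_le_of_lt_of_isPrime h12
  have e3 := Ideal.height_add_one_le_of_lt_of_isPrime h23
  have e4 := Ideal.height_le_ringKrullDim_of_isPrime (I := I₃)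
  rw [MvPolynomial.ringKrullDim_of_isNoetherianRing, ringKrullDim_eq_zero_of_field] at e4
  have e5 : I₃.height ≤ 2 := by
    simp only [Nat.card_eq_fintype_card, Fintype.card_fin, zero_add] at e4
    exact WithBot.coe_le_coe.mp e4
  rw [Ideal.height_bot] at e1
  have : (3 : ℕ∞) ≤ 2 := calc
    (3 : ℕ∞) = 0 + 1 + 1 + 1 := by norm_num
    _ ≤ I₃.height := by grw [e1, e2, e3]
    _ ≤ 2 := e5
  exact absurd this (by norm_num)

end Kernel

end SimpleCongruence

namespace SimpleCongruence

/-! ### Derivations of the polynomial ring -/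

section Derivations

open MvPolynomial

variable (ℓ : ℕ) [Fact ℓ.Prime]

/-- The Euler derivation, multiplying a polynomial of weight `n` by `n`. -/
noncomputable def euler :
    Derivation (ZMod ℓ) (MvPolynomial (Fin 2) (ZMod ℓ)) (MvPolynomial (Fin 2) (ZMod ℓ)) :=
  (4 * X 0 : MvPolynomial (Fin 2) (ZMod ℓ)) • pderiv 0 +
    (6 * X 1 : MvPolynomial (Fin 2) (ZMod ℓ)) • pderiv 1

/-- The derivation of weight 2 corresponding to twelve times the Serre derivative. -/
noncomputable def del :
    Derivation (ZMod ℓ) (MvPolynomial (Fin 2) (ZMod ℓ)) (MvPolynomial (Fin 2) (ZMod ℓ)) :=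
  (-4 * X 1 : MvPolynomial (Fin 2) (ZMod ℓ)) • pderiv 0 +
    (-6 * X 0 ^ 2 : MvPolynomial (Fin 2) (ZMod ℓ)) • pderiv 1

variable {ℓ}

lemma euler_X : euler ℓ (X 0) = 4 * X 0 ∧ euler ℓ (X 1) = 6 * X 1 := by
  simp [euler, pderiv_X]

lemma del_X : del ℓ (X 0) = -4 * X 1 ∧ del ℓ (X 1) = -6 * X 0 ^ 2 := by
  simp [del, pderiv_X]

lemma euler_of_homogeneous {f : MvPolynomial (Fin 2) (ZMod ℓ)} {n : ℕ}
    (hf : IsWeightedHomogeneous wt f n) : euler ℓ f = n * f := by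
  have := hf.sum_weight_X_mul_pderiv
  simp only [Fin.sum_univ_two, wt, Matrix.cons_val_zero, Matrix.cons_val_one, nsmul_eq_mul] at this
  rw [← this]
  simp [euler]
  ring

/-- When `wt i > n` the variable `X i` cannot occur in `f`, so the derivative is zero and truncated
subtraction of weights does no harm. -/
lemma homogeneous_mul_pderiv {f g : MvPolynomial (Fin 2) (ZMod ℓ)} {n m : ℕ} (i : Fin 2)
    (hf : IsWeightedHomogeneous wt f n) (hg : IsWeightedHomogeneous wt g (wt i + m)) :
    IsWeightedHomogeneous wt (g * pderiv i f) (n + m) := by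
  by_cases h : wt i ≤ n
  · have := hg.mul (hf.pderiv (i := i) (n' := n - wt i) (by omega))
    rwa [show wt i + m + (n - wt i) = n + m by omega] at this
  · rw [pderiv_eq_zero_of_notMem_vars, mul_zero]
    · exact isWeightedHomogeneous_zero _ _ _
    · intro hi
      obtain ⟨d, hd, hid⟩ := (mem_vars_iff_mem_support i).mp hi
      have h1 := hf (mem_support_iff.mp hd)
      have h2 : 1 ≤ d i := Nat.one_le_iff_ne_zero.mpr (Finsupp.mem_support_iff.mp hid)
      rw [weight_wt] at h1
      fin_cases i <;> simp [wt] at h h2 <;> omega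

lemma homogeneous_ofNat_mul {f : MvPolynomial (Fin 2) (ZMod ℓ)} {n : ℕ} (a : ℤ)
    (hf : IsWeightedHomogeneous wt f n) : IsWeightedHomogeneous wt ((a : MvPolynomial _ _) * f) n := by
  rw [← map_intCast (C : ZMod ℓ →+* MvPolynomial (Fin 2) (ZMod ℓ)) a]
  exact hf.C_mul _

lemma homogeneous_del {f : MvPolynomial (Fin 2) (ZMod ℓ)} {n : ℕ}
    (hf : IsWeightedHomogeneous wt f n) : IsWeightedHomogeneous wt (del ℓ f) (n + 2) := by
  have h1 := homogeneous_mul_pderiv (m := 2) 0 hf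
    (homogeneous_ofNat_mul (-4) (homogeneous_X_one (ℓ := ℓ)))
  have h2 := homogeneous_mul_pderiv (m := 2) 1 hf
    (homogeneous_ofNat_mul (-6) ((homogeneous_X_zero (ℓ := ℓ)).pow 2))
  have := h1.add h2
  simpa [del] using this

lemma bar_ramanujan :
    12 * theta (ZMod ℓ) (bar ℓ eisP) = bar ℓ eisP ^ 2 - bar ℓ eisQ ∧
    3 * theta (ZMod ℓ) (bar ℓ eisQ) = bar ℓ eisP * bar ℓ eisQ - bar ℓ eisR ∧
    2 * theta (ZMod ℓ) (bar ℓ eisR) = bar ℓ eisP * bar ℓ eisR - bar ℓ eisQ ^ 2 := by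
  have h1 := congrArg (bar ℓ) ramanujan_eisP
  have h2 := congrArg (bar ℓ) ramanujan_eisQ
  have h3 := congrArg (bar ℓ) ramanujan_eisR
  simp only [bar, map_mul, map_sub, map_pow, map_ofNat, map_theta] at h1 h2 h3 ⊢
  exact ⟨h1, h2, h3⟩

/-- Both sides are derivations along `phi`, so it suffices to compare them on the generators, where
they agree by Ramanujan's equations. -/
lemma phi_del (f : MvPolynomial (Fin 2) (ZMod ℓ)) :
    phi ℓ (del ℓ f) = 12 * theta (ZMod ℓ) (phi ℓ f) - bar ℓ eisP * phi ℓ (euler ℓ f) := by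
  obtain ⟨-, hQ, hR⟩ := bar_ramanujan (ℓ := ℓ)
  have hX : ∀ i, phi ℓ (del ℓ (X i)) =
      12 * theta (ZMod ℓ) (phi ℓ (X i)) - bar ℓ eisP * phi ℓ (euler ℓ (X i)) := by
    intro i
    fin_cases i
    · simp only [Fin.zero_eta, del_X.1, euler_X.1, map_mul, map_neg, map_ofNat, phi_X_zero,
        phi_X_one]
      linear_combination (-4) * hQ
    · simp only [Fin.mk_one, del_X.2, euler_X.2, map_mul, map_neg, map_ofNat, phi_X_zero,
        phi_X_one, map_pow]
      linear_combination (-6) * hR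
  induction f using MvPolynomial.induction_on with
  | C a =>
    have : theta (ZMod ℓ) (PowerSeries.C a) = 0 := (theta (ZMod ℓ)).map_algebraMap a
    simp [this]
  | add p q hp hq => simp only [map_add, hp, hq]; ring
  | mul_X p i hp =>
    simp only [Derivation.leibniz, map_add, map_mul, smul_eq_mul]
    linear_combination phi ℓ p * hX i + phi ℓ (X i) * hp

lemma phi_del_of_homogeneous {f : MvPolynomial (Fin 2) (ZMod ℓ)} {n : ℕ}
    (hf : IsWeightedHomogeneous wt f n) :
    phi ℓ (del ℓ f) = 12 * theta (ZMod ℓ) (phi ℓ f) - n * bar ℓ eisP * phi ℓ f := by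
  rw [phi_del, euler_of_homogeneous hf, map_mul, map_natCast]
  ring

end Derivations

/-! ### The Hasse invariant is squarefree and prime to its derivative -/

section Hasse

open MvPolynomial

variable {ℓ : ℕ} [Fact ℓ.Prime] {A : MvPolynomial (Fin 2) (ZMod ℓ)}

lemma sub_one_ne_zero_of_homogeneous (hℓ : 5 ≤ ℓ) (hA : IsWeightedHomogeneous wt A (ℓ - 1)) :
    A - 1 ≠ 0 := by
  intro h
  have := (isWeightedHomogeneous_one (ZMod ℓ) wt).inj_right one_ne_zero
    (by rwa [sub_eq_zero.mp h] at hA)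
  omega

/-- The reduction of a nonzero form of given weight is nonzero. -/
lemma phi_ne_zero_of_homogeneous (hℓ : 5 ≤ ℓ) (hA : IsWeightedHomogeneous wt A (ℓ - 1))
    (hA1 : phi ℓ A = 1) {f : MvPolynomial (Fin 2) (ZMod ℓ)} {n : ℕ}
    (hf : IsWeightedHomogeneous wt f n) (h0 : f ≠ 0) : phi ℓ f ≠ 0 := by
  intro hphi
  obtain ⟨s, hs, hsf⟩ := UniqueFactorizationMonoid.exists_prime_factors f h0
  have hker : (RingHom.ker (phi ℓ)).IsPrime := RingHom.ker_isPrime _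
  have hmem : s.prod ∈ RingHom.ker (phi ℓ) := by
    obtain ⟨u, hu⟩ := hsf.symm
    rw [← hu]
    exact Ideal.mul_mem_right _ _ hphi
  obtain ⟨p, hps, hp⟩ := (Ideal.IsPrime.multiset_prod_mem_iff_exists_mem hker s).mp hmem
  obtain ⟨g, hg⟩ : p ∣ f := (Multiset.dvd_prod hps).trans hsf.dvd
  obtain ⟨d, e, hd, -, -⟩ := homogeneous_of_mul (hg ▸ h0) (hg ▸ hf)
  obtain ⟨r, hr⟩ := dvd_of_phi_eq_zero hℓ (h := A - 1) (hs p hps) hp (by simp [hA1])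
  -- Compare weight-zero parts in A - 1 = p r: the left gives -1, while the right gives 0 if p has
  -- positive weight and a multiple of p otherwise.
  have h1 := congrArg (fun x ↦ (tau x).coeff 0) hr
  simp only [map_sub, map_one, map_mul, homogeneous_iff_tau.mp hA, homogeneous_iff_tau.mp hd,
    Polynomial.coeff_sub, Polynomial.coeff_monomial, Polynomial.mul_coeff_zero,
    Polynomial.coeff_one_zero] at h1
  rw [if_neg (by omega), zero_sub] at h1
  split_ifs at h1 with hd0
  · exact (hs p hps).not_isUnit (isUnit_of_dvd_one ⟨-(tau r).coeff 0, by rw [mul_neg, ← h1, neg_neg]⟩)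
  · simp at h1

lemma eq_of_phi_eq (hℓ : 5 ≤ ℓ) (hA : IsWeightedHomogeneous wt A (ℓ - 1))
    (hA1 : phi ℓ A = 1) {f g : MvPolynomial (Fin 2) (ZMod ℓ)} {n : ℕ}
    (hf : IsWeightedHomogeneous wt f n) (hg : IsWeightedHomogeneous wt g n)
    (h : phi ℓ f = phi ℓ g) : f = g := by
  by_contra hne
  exact phi_ne_zero_of_homogeneous hℓ hA hA1 (hf.sub hg) (sub_ne_zero.mpr hne)
    (by rw [map_sub, h, sub_self])

omit [Fact ℓ.Prime] in
lemma natCast_prime_sub_one (hℓ : 5 ≤ ℓ) {R : Type*} [CommRing R] [CharP R ℓ] :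
    ((ℓ - 1 : ℕ) : R) = -1 := by
  rw [Nat.cast_sub (by omega), CharP.cast_eq_zero]
  simp

lemma phi_del_hasse (hℓ : 5 ≤ ℓ) (hA : IsWeightedHomogeneous wt A (ℓ - 1))
    (hA1 : phi ℓ A = 1) : phi ℓ (del ℓ A) = bar ℓ eisP := by
  have h : theta (ZMod ℓ) 1 = 0 := Derivation.map_one_eq_zero _
  have : CharP (PowerSeries (ZMod ℓ)) ℓ :=
    charP_of_injective_algebraMap (algebraMap (ZMod ℓ) (PowerSeries (ZMod ℓ))).injective ℓ
  rw [phi_del_of_homogeneous hA, hA1, h, natCast_prime_sub_one hℓ]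
  ring

/-- As `del ℓ A` has weight ℓ + 1 ≡ 1 and reduces to E₂, this is Ramanujan's equation for E₂. The
resulting second-order equation for A excludes repeated factors. -/
lemma del_del_hasse (hℓ : 5 ≤ ℓ) (hA : IsWeightedHomogeneous wt A (ℓ - 1))
    (hA1 : phi ℓ A = 1) : del ℓ (del ℓ A) = -(X 0 * A) := by
  have hB := homogeneous_del hA
  have : CharP (PowerSeries (ZMod ℓ)) ℓ :=
    charP_of_injective_algebraMap (algebraMap (ZMod ℓ) (PowerSeries (ZMod ℓ))).injective ℓ
  refine eq_of_phi_eq hℓ hA hA1 (homogeneous_del hB) (n := ℓ - 1 + 2 + 2) ?_ ?_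
  · have := (homogeneous_X_zero (ℓ := ℓ)).mul hA
    rw [show 4 + (ℓ - 1) = ℓ - 1 + 2 + 2 by omega] at this
    exact this.neg
  · rw [phi_del_of_homogeneous hB, phi_del_hasse hℓ hA hA1, map_neg, map_mul, hA1, phi_X_zero]
    push_cast
    rw [natCast_prime_sub_one hℓ]
    linear_combination (bar_ramanujan (ℓ := ℓ)).1

/-- A prime factor of `A` does not divide its own derivative. -/
lemma not_dvd_del_self (hℓ : 5 ≤ ℓ) (hA : IsWeightedHomogeneous wt A (ℓ - 1))
    (hA1 : phi ℓ A = 1) {p : MvPolynomial (Fin 2) (ZMod ℓ)} (hp : Prime p) (hpA : p ∣ A) :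
    ¬ p ∣ del ℓ p := by
  have hA0 : A ≠ 0 := by rintro rfl; simp at hA1
  obtain ⟨r, hr⟩ := hpA
  obtain ⟨d, e, hd, -, hde⟩ := homogeneous_of_mul (hr ▸ hA0) (hr ▸ hA)
  have hd0 : 0 < d := by
    rw [Nat.pos_iff_ne_zero]
    rintro rfl
    exact hp.not_isUnit (isUnit_of_homogeneous_zero hp.ne_zero hd)
  -- If the derivative vanished, the constant term of `phi ℓ p` times d would be 0. But 0 < d < ℓ,
  -- and that constant term is a unit because p r = A reduces to 1.
  have hdel : ¬ del ℓ p = 0 := by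
    intro h
    have h1 := phi_del_of_homogeneous hd
    rw [h, map_zero] at h1
    have h2 := congrArg (PowerSeries.coeff 0) h1
    have h3 : (12 * theta (ZMod ℓ) (phi ℓ p)).coeff 0 = 0 := by
      rw [← map_ofNat (PowerSeries.C (R := ZMod ℓ)) 12, PowerSeries.coeff_C_mul, coeff_theta]
      simp
    rw [map_sub, h3, map_zero, zero_sub, eq_comm, neg_eq_zero,
      PowerSeries.coeff_zero_eq_constantCoeff_apply, map_mul, map_mul, (constantCoeff_eis _).1,
      map_natCast, mul_one] at h2
    have h4 : (d : ZMod ℓ) ≠ 0 := by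
      rw [Ne, ZMod.natCast_eq_zero_iff]
      intro h
      have := Nat.le_of_dvd hd0 h
      omega
    have h5 := congrArg PowerSeries.constantCoeff hA1
    rw [hr, map_mul, map_mul, (mul_eq_zero.mp h2).resolve_left h4] at h5
    simp at h5
  rintro ⟨g, hg⟩
  obtain ⟨a, b, ha, hb, hab⟩ := homogeneous_of_mul (hg ▸ hdel) (hg ▸ homogeneous_del hd)
  have := ha.inj_right hp.ne_zero hd
  -- The quotient would have weight 2, where only the zero polynomial lives.
  obtain rfl : b = 2 := by omega
  rw [eq_zero_of_homogeneous_two hb, mul_zero] at hg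
  exact hdel hg

/-- `A` has no repeated factors and is prime to its derivative. -/
lemma not_dvd_del_hasse (hℓ : 5 ≤ ℓ) (hA : IsWeightedHomogeneous wt A (ℓ - 1))
    (hA1 : phi ℓ A = 1) {p : MvPolynomial (Fin 2) (ZMod ℓ)} (hp : Prime p) (hpA : p ∣ A) :
    ¬ p ∣ del ℓ A ∧ ¬ p ^ 2 ∣ A := by
  have hA0 : A ≠ 0 := by rintro rfl; simp at hA1
  have hself := not_dvd_del_self hℓ hA hA1 hp hpA
  have hcast : ∀ m : ℕ, 0 < m → m < ℓ → ¬ p ∣ (m : MvPolynomial (Fin 2) (ZMod ℓ)) := by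
    intro m hm hmℓ h
    refine hp.not_isUnit (isUnit_of_dvd_unit h ?_)
    rw [← map_natCast (C : ZMod ℓ →+* MvPolynomial (Fin 2) (ZMod ℓ)) m]
    refine (isUnit_iff_ne_zero.mpr ?_).map C
    rw [Ne, ZMod.natCast_eq_zero_iff]
    exact fun h ↦ absurd (Nat.le_of_dvd hm h) (by omega)
  obtain ⟨r, hAr, hr⟩ :=
    (FiniteMultiplicity.of_prime_left hp hA0).exists_eq_pow_mul_and_not_dvd
  set n := multiplicity p A
  have hnℓ : n < ℓ := by
    obtain ⟨a, b, ha, -, hab⟩ := homogeneous_of_mul (hAr ▸ hA0) (hAr ▸ hA)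
    obtain ⟨g, hg⟩ := hpA
    obtain ⟨d, -, hd, -, -⟩ := homogeneous_of_mul (hg ▸ hA0) (hg ▸ hA)
    have h1 := (hd.pow n).inj_right (pow_ne_zero n hp.ne_zero) ha
    have hd0 : 0 < d := by
      rw [Nat.pos_iff_ne_zero]
      rintro rfl
      exact hp.not_isUnit (isUnit_of_homogeneous_zero hp.ne_zero hd)
    have : n ≤ a := by rw [← h1]; exact Nat.le_mul_of_pos_right n hd0
    omega
  obtain ⟨k, hk⟩ : ∃ k, n = k + 1 := by
    refine Nat.exists_eq_succ_of_ne_zero fun h0 ↦ ?_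
    rw [h0, pow_zero, one_mul] at hAr
    exact hr (hAr ▸ hpA)
  rw [hk] at hAr hnℓ
  set s := p * del ℓ r + ((k + 1 : ℕ) : MvPolynomial (Fin 2) (ZMod ℓ)) * (r * del ℓ p) with hs
  have hps : ¬ p ∣ s := by
    rw [hs, dvd_add_right (dvd_mul_right _ _), hp.dvd_mul, hp.dvd_mul]
    rintro (h | h | h)
    · exact hcast _ k.succ_pos hnℓ h
    · exact hr h
    · exact hself h
  have hB : del ℓ A = p ^ k * s := by
    rw [hAr, Derivation.leibniz, Derivation.leibniz_pow, hs]
    simp only [smul_eq_mul, nsmul_eq_mul, Nat.add_sub_cancel]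
    ring
  -- If k ≥ 1, then p divides the first derivative of A exactly k times and the second exactly k - 1
  -- times, whereas the second derivative is a multiple of A.
  obtain rfl : k = 0 := by
    by_contra hk0
    obtain ⟨j, rfl⟩ := Nat.exists_eq_succ_of_ne_zero hk0
    have h1 := del_del_hasse hℓ hA hA1
    rw [hB, Derivation.leibniz, Derivation.leibniz_pow] at h1
    simp only [smul_eq_mul, nsmul_eq_mul, Nat.succ_eq_add_one, Nat.add_sub_cancel] at h1
    have h2 : p ^ j * (((j + 1 : ℕ) : MvPolynomial (Fin 2) (ZMod ℓ)) * (del ℓ p * s)) =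
        p ^ j * (p * (-(X 0 * p * r) - del ℓ s)) := by
      rw [hAr] at h1
      simp only [Nat.succ_eq_add_one] at h1
      linear_combination h1
    have h3 := (mul_left_cancel₀ (pow_ne_zero _ hp.ne_zero) h2)
    have h4 : p ∣ ((j + 1 : ℕ) : MvPolynomial (Fin 2) (ZMod ℓ)) * (del ℓ p * s) :=
      h3 ▸ dvd_mul_right _ _
    rw [hp.dvd_mul, hp.dvd_mul] at h4
    rcases h4 with h | h | h
    · exact hcast _ j.succ_pos (by omega) h
    · exact hself h
    · exact hps h
  refine ⟨by rwa [hB, pow_zero, one_mul], ?_⟩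
  rw [hAr, zero_add, pow_one, sq]
  intro h
  exact hr ((mul_dvd_mul_iff_left hp.ne_zero).mp h)

end Hasse

end SimpleCongruence

namespace SimpleCongruence

/-! ### Separating weights mod ℓ - 1 -/

section Separation

open MvPolynomial

variable {ℓ : ℕ} [Fact ℓ.Prime] {A : MvPolynomial (Fin 2) (ZMod ℓ)}

/-- The kernel is generated by a prime p dividing A - 1, and `sigma t` fixes A - 1 since t^(ℓ-1) =
1. If p ∤ `sigma t p`, their product divides A - 1; taking top-weight parts, the square of a nonunit
divides A, which is squarefree. -/
lemma phi_sigma_eq_zero (hℓ : 5 ≤ ℓ) (hA : IsWeightedHomogeneous wt A (ℓ - 1))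
    (hA1 : phi ℓ A = 1) {t : ZMod ℓ} (ht : t ≠ 0) {h : MvPolynomial (Fin 2) (ZMod ℓ)}
    (hh : phi ℓ h = 0) : phi ℓ (sigma t h) = 0 := by
  have hker : (RingHom.ker (phi ℓ)).IsPrime := RingHom.ker_isPrime _
  have hA0 : A - 1 ≠ 0 := sub_one_ne_zero_of_homogeneous hℓ hA
  have hAker : phi ℓ (A - 1) = 0 := by rw [map_sub, hA1, map_one, sub_self]
  obtain ⟨p, hpker, hp⟩ := hker.exists_mem_prime_of_ne_bot
    (fun h ↦ hA0 (by rw [← Ideal.mem_bot, ← h]; exact hAker))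
  obtain ⟨h', rfl⟩ := dvd_of_phi_eq_zero hℓ hp hpker hh
  rw [map_mul, map_mul]
  by_cases hdvd : p ∣ sigma t p
  · obtain ⟨g, hg⟩ := hdvd
    have hp0 : phi ℓ p = 0 := hpker
    rw [hg, map_mul, hp0, zero_mul, zero_mul]
  exfalso
  obtain ⟨r, hr⟩ := dvd_of_phi_eq_zero hℓ hp hpker hAker
  have hσ : sigma t (A - 1) = A - 1 := by
    rw [map_sub, map_one, sigma_of_homogeneous t hA, ZMod.pow_card_sub_one_eq_one ht, map_one,
      one_mul]
  have h1 : A - 1 = sigma t p * sigma t r := by rw [← map_mul, ← hr, hσ]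
  obtain ⟨q, hq⟩ : p ∣ sigma t r :=
    (hp.dvd_or_dvd (h1 ▸ hr ▸ dvd_mul_right p r)).resolve_left hdvd
  rw [hq] at h1
  have hlead : (tau (A - 1)).leadingCoeff = A := by
    have hA0' : A ≠ 0 := by rintro rfl; simp at hA1
    rw [map_sub, map_one, homogeneous_iff_tau.mp hA, Polynomial.leadingCoeff_sub_of_degree_lt,
      Polynomial.leadingCoeff_monomial]
    rw [Polynomial.degree_one, Polynomial.degree_monomial _ hA0']
    exact_mod_cast (by omega : 0 < ℓ - 1)
  set u := (tau p).leadingCoeff with hu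
  have hu2 : u ^ 2 ∣ A := by
    rw [← hlead, h1, map_mul, map_mul, Polynomial.leadingCoeff_mul, Polynomial.leadingCoeff_mul,
      sq]
    exact mul_dvd_mul (leadingCoeff_tau_sigma ht p) (dvd_mul_right _ _)
  have hu0 : u ≠ 0 := by
    rw [hu, Polynomial.leadingCoeff_ne_zero]
    intro h
    apply hp.ne_zero
    rw [← eval_one_tau p, h, Polynomial.eval_zero]
  have hdeg : 0 < (tau p).natDegree := by
    rw [Nat.pos_iff_ne_zero]
    intro h0
    refine phi_ne_zero_of_homogeneous hℓ hA hA1 (f := p) (n := 0) ?_ hp.ne_zero hpker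
    have h2 := Polynomial.eq_C_of_natDegree_eq_zero h0
    exact homogeneous_of_tau_eq (g := (tau p).coeff 0) h2
  have hunit : ¬ IsUnit u := not_isUnit_of_homogeneous hdeg (homogeneous_leadingCoeff_tau p)
  obtain ⟨π, hπ, hπu⟩ := WfDvdMonoid.exists_irreducible_factor hunit hu0
  have hπ2 : π ^ 2 ∣ A := (pow_dvd_pow_of_dvd hπu 2).trans hu2
  exact (not_dvd_del_hasse hℓ hA hA1 hπ.prime ((dvd_pow_self π two_ne_zero).trans hπ2)).2 hπ2

/-- The weights mod `ℓ - 1` of a congruence between forms can be separated. -/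
theorem sum_phi_eq_zero_of_class (hℓ : 5 ≤ ℓ) (hA : IsWeightedHomogeneous wt A (ℓ - 1))
    (hA1 : phi ℓ A = 1) {ι : Type*} (s : Finset ι) (h : ι → MvPolynomial (Fin 2) (ZMod ℓ))
    (k : ι → ℕ) (hk : ∀ i ∈ s, IsWeightedHomogeneous wt (h i) (k i))
    (h0 : ∑ i ∈ s, phi ℓ (h i) = 0) (m : ℕ) :
    ∑ i ∈ s with k i ≡ m [MOD ℓ - 1], phi ℓ (h i) = 0 := by
  have hφ : phi ℓ (∑ i ∈ s, h i) = 0 := by rw [map_sum, h0]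
  -- As ℓ - 2 ≡ -1 mod ℓ - 1, t^N plays the role of t^(-m). Summing t^(N + k) over the units gives
  -- -1 when k ≡ m and 0 otherwise.
  set N := (ℓ - 2) * m
  have key : ∑ t : (ZMod ℓ)ˣ, PowerSeries.C (((t : ZMod ℓ)) ^ N) *
      phi ℓ (sigma (t : ZMod ℓ) (∑ i ∈ s, h i)) = 0 :=
    Finset.sum_eq_zero fun t _ ↦ by
      rw [phi_sigma_eq_zero hℓ hA hA1 t.ne_zero hφ, mul_zero]
  have hterm : ∀ t : (ZMod ℓ)ˣ, PowerSeries.C (((t : ZMod ℓ)) ^ N) *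
      phi ℓ (sigma (t : ZMod ℓ) (∑ i ∈ s, h i)) =
      ∑ i ∈ s, PowerSeries.C ((t : ZMod ℓ) ^ (N + k i)) * phi ℓ (h i) := by
    intro t
    rw [map_sum, map_sum, Finset.mul_sum]
    refine Finset.sum_congr rfl fun i hi ↦ ?_
    rw [sigma_of_homogeneous _ (hk i hi), map_mul, phi_C, ← mul_assoc, ← map_mul, ← pow_add]
  simp only [hterm] at key
  rw [Finset.sum_comm] at key
  have hsum : ∀ i, ∑ t : (ZMod ℓ)ˣ, PowerSeries.C ((t : ZMod ℓ) ^ (N + k i)) * phi ℓ (h i) =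
      if k i ≡ m [MOD ℓ - 1] then -phi ℓ (h i) else 0 := by
    intro i
    have h1 : (∑ t : (ZMod ℓ)ˣ, ((t ^ (N + k i) : (ZMod ℓ)ˣ) : ZMod ℓ)) = _ :=
      FiniteField.sum_pow_units (ZMod ℓ) (N + k i)
    have h2 : (ℓ - 1 ∣ N + k i) ↔ k i ≡ m [MOD ℓ - 1] := by
      have hN : N + m = (ℓ - 1) * m := by
        obtain ⟨l, rfl⟩ : ∃ l, ℓ = l + 2 := ⟨ℓ - 2, by omega⟩
        simp only [N, Nat.add_sub_cancel, show l + 2 - 1 = l + 1 by omega]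
        ring
      rw [← Nat.modEq_zero_iff_dvd]
      have hN0 : N + m ≡ 0 [MOD ℓ - 1] := by
        rw [Nat.modEq_zero_iff_dvd, hN]
        exact dvd_mul_right _ _
      constructor
      · exact fun h ↦ Nat.ModEq.add_left_cancel' N (h.trans hN0.symm)
      · exact fun h ↦ (h.add_left N).trans hN0
    rw [← Finset.sum_mul, ← map_sum]
    simp only [Units.val_pow_eq_pow_val, ZMod.card, h2] at h1
    rw [h1]
    split_ifs <;> simp
  simp only [hsum] at key
  rw [← Finset.sum_filter, Finset.sum_neg_distrib, neg_eq_zero] at key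
  exact key

end Separation

/-! ### The theta operator on polynomials -/

section ThetaLift

open MvPolynomial

variable {ℓ : ℕ} [Fact ℓ.Prime]

/-- The lift of `12 q d/dq` to polynomials, of weight `ℓ + 1`. -/
noncomputable def thetaLift (A : MvPolynomial (Fin 2) (ZMod ℓ)) :
    Derivation (ZMod ℓ) (MvPolynomial (Fin 2) (ZMod ℓ)) (MvPolynomial (Fin 2) (ZMod ℓ)) :=
  A • del ℓ + del ℓ A • euler ℓ

variable {A : MvPolynomial (Fin 2) (ZMod ℓ)}

lemma thetaLift_of_homogeneous {f : MvPolynomial (Fin 2) (ZMod ℓ)} {n : ℕ}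
    (hf : IsWeightedHomogeneous wt f n) :
    thetaLift A f = A * del ℓ f + n * (del ℓ A * f) := by
  simp only [thetaLift, Derivation.add_apply, Derivation.smul_apply, smul_eq_mul,
    euler_of_homogeneous hf]
  ring

lemma phi_thetaLift (hℓ : 5 ≤ ℓ) (hA : IsWeightedHomogeneous wt A (ℓ - 1))
    (hA1 : phi ℓ A = 1) (f : MvPolynomial (Fin 2) (ZMod ℓ)) :
    phi ℓ (thetaLift A f) = 12 * theta (ZMod ℓ) (phi ℓ f) := by
  simp only [thetaLift, Derivation.add_apply, Derivation.smul_apply, smul_eq_mul, map_add,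
    map_mul, hA1, phi_del_hasse hℓ hA hA1, phi_del f]
  ring

lemma thetaLift_hasse (hℓ : 5 ≤ ℓ) (hA : IsWeightedHomogeneous wt A (ℓ - 1)) :
    thetaLift A A = 0 := by
  rw [thetaLift_of_homogeneous hA, natCast_prime_sub_one hℓ]
  ring

lemma homogeneous_thetaLift (hℓ : 5 ≤ ℓ) (hA : IsWeightedHomogeneous wt A (ℓ - 1))
    {f : MvPolynomial (Fin 2) (ZMod ℓ)} {n : ℕ} (hf : IsWeightedHomogeneous wt f n) :
    IsWeightedHomogeneous wt (thetaLift A f) (n + (ℓ + 1)) := by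
  rw [thetaLift_of_homogeneous hf]
  have h1 := hA.mul (homogeneous_del hf)
  have h2 := homogeneous_ofNat_mul n ((homogeneous_del hA).mul hf)
  rw [show ℓ - 1 + (n + 2) = n + (ℓ + 1) by omega] at h1
  rw [show ℓ - 1 + 2 + n = n + (ℓ + 1) by omega] at h2
  exact_mod_cast h1.add h2

lemma homogeneous_iterate_thetaLift (hℓ : 5 ≤ ℓ) (hA : IsWeightedHomogeneous wt A (ℓ - 1))
    {f : MvPolynomial (Fin 2) (ZMod ℓ)} {n : ℕ} (hf : IsWeightedHomogeneous wt f n) (i : ℕ) :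
    IsWeightedHomogeneous wt ((thetaLift A)^[i] f) (n + i * (ℓ + 1)) := by
  induction i with
  | zero => simpa using hf
  | succ i ih =>
    rw [Function.iterate_succ_apply']
    have := homogeneous_thetaLift hℓ hA ih
    rwa [show n + i * (ℓ + 1) + (ℓ + 1) = n + (i + 1) * (ℓ + 1) by ring] at this

lemma iterate_thetaLift_hasse_pow_mul (hℓ : 5 ≤ ℓ) (hA : IsWeightedHomogeneous wt A (ℓ - 1))
    (f : MvPolynomial (Fin 2) (ZMod ℓ)) (s i : ℕ) :
    (thetaLift A)^[i] (A ^ s * f) = A ^ s * (thetaLift A)^[i] f := by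
  induction i with
  | zero => rfl
  | succ i ih =>
    rw [Function.iterate_succ_apply', ih, Function.iterate_succ_apply', Derivation.leibniz,
      Derivation.leibniz_pow, thetaLift_hasse hℓ hA]
    simp

/-- If the weight of `f` is prime to `ℓ` and `f` has exact filtration, then so has its
derivative. -/
lemma not_dvd_thetaLift (hℓ : 5 ≤ ℓ) (hA : IsWeightedHomogeneous wt A (ℓ - 1))
    (hA1 : phi ℓ A = 1) {f : MvPolynomial (Fin 2) (ZMod ℓ)} {n : ℕ}
    (hf : IsWeightedHomogeneous wt f n) (hn : ¬ ℓ ∣ n) (hAf : ¬ A ∣ f) :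
    ¬ A ∣ thetaLift A f := by
  have hA0 : A ≠ 0 := by rintro rfl; simp at hA1
  intro h
  rw [thetaLift_of_homogeneous hf, dvd_add_right (dvd_mul_right _ _)] at h
  have hu : IsUnit (n : MvPolynomial (Fin 2) (ZMod ℓ)) := by
    rw [← map_natCast (C : ZMod ℓ →+* MvPolynomial (Fin 2) (ZMod ℓ)) n]
    refine (isUnit_iff_ne_zero.mpr ?_).map C
    rwa [Ne, ZMod.natCast_eq_zero_iff]
  rw [hu.dvd_mul_left] at h
  have hrel : IsRelPrime A (del ℓ A) :=
    (UniqueFactorizationMonoid.isRelPrime_iff_no_prime_factors hA0).mpr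
      fun p h1 h2 hp ↦ (not_dvd_del_hasse hℓ hA hA1 hp h1).1 h2
  exact hAf (hrel.dvd_of_dvd_mul_left h)

/-- Each application adds ℓ + 1 ≡ 1 to the weight mod ℓ, so the i-th iterate has weight ≡ n + i. -/
lemma not_dvd_iterate_thetaLift (hℓ : 5 ≤ ℓ) (hA : IsWeightedHomogeneous wt A (ℓ - 1))
    (hA1 : phi ℓ A = 1) {f : MvPolynomial (Fin 2) (ZMod ℓ)} {n : ℕ}
    (hf : IsWeightedHomogeneous wt f n) (hAf : ¬ A ∣ f) (r : ℕ)
    (hn : ∀ i < r, ¬ ℓ ∣ n + i) : ¬ A ∣ (thetaLift A)^[r] f := by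
  induction r with
  | zero => exact hAf
  | succ r ih =>
    rw [Function.iterate_succ_apply']
    refine not_dvd_thetaLift hℓ hA hA1 (homogeneous_iterate_thetaLift hℓ hA hf r) ?_
      (ih fun i hi ↦ hn i (by omega))
    rw [show n + r * (ℓ + 1) = n + r + ℓ * r by ring, Nat.dvd_add_left (dvd_mul_right _ _)]
    exact hn r (by omega)

end ThetaLift

end SimpleCongruence

namespace SimpleCongruence

/-! ### The functional equation and the weight bounds -/

section Bounds

open MvPolynomial

variable {ℓ : ℕ} [Fact ℓ.Prime] {A : MvPolynomial (Fin 2) (ZMod ℓ)}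

lemma coeff_phi_iterate_thetaLift (hℓ : 5 ≤ ℓ) (hA : IsWeightedHomogeneous wt A (ℓ - 1))
    (hA1 : phi ℓ A = 1) (f : MvPolynomial (Fin 2) (ZMod ℓ)) (j n : ℕ) :
    (phi ℓ ((thetaLift A)^[j] f)).coeff n = (12 * n : ZMod ℓ) ^ j * (phi ℓ f).coeff n := by
  induction j with
  | zero => simp
  | succ j ih =>
    rw [Function.iterate_succ_apply', phi_thetaLift hℓ hA hA1,
      ← map_ofNat (PowerSeries.C (R := ZMod ℓ)) 12, PowerSeries.coeff_C_mul, coeff_theta, ih]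
    ring

/-- A form whose coefficients vanish on a residue class `c` is a combination of its derivatives. -/
lemma sum_phi_iterate_thetaLift_eq_zero (hℓ : 5 ≤ ℓ) (hA : IsWeightedHomogeneous wt A (ℓ - 1))
    (hA1 : phi ℓ A = 1) (f : MvPolynomial (Fin 2) (ZMod ℓ)) {c : ZMod ℓ} (hc : c ≠ 0)
    (hf : ∀ n : ℕ, (12 * n : ZMod ℓ) = c → (phi ℓ f).coeff n = 0) :
    ∑ j ∈ Finset.Ico 1 ℓ, phi ℓ (C (c ^ (ℓ - 1 - j)) * (thetaLift A)^[j] f) = 0 := by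
  ext n
  simp only [map_sum, map_mul, phi_C, PowerSeries.coeff_C_mul,
    coeff_phi_iterate_thetaLift hℓ hA hA1, map_zero]
  by_cases h : (12 * n : ZMod ℓ) = c
  · simp [hf n h]
  -- By Fermat, (x^ℓ - c^ℓ)/(x - c) = 1 for x ≠ c. Its j = 0 term is c^(ℓ-1) = 1, so the remaining
  -- terms sum to 0.
  · have h1 := geom_sum₂_mul (12 * n : ZMod ℓ) c ℓ
    rw [ZMod.pow_card, ZMod.pow_card] at h1
    have h2 := mul_right_cancel₀ (sub_ne_zero.mpr h) (h1.trans (one_mul _).symm)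
    rw [Finset.range_eq_Ico, Finset.sum_eq_sum_Ico_succ_bot (by omega), pow_zero, one_mul,
      Nat.sub_zero, ZMod.pow_card_sub_one_eq_one hc, add_eq_left] at h2
    rw [← zero_mul ((phi ℓ f).coeff n), ← h2, Finset.sum_mul]
    refine Finset.sum_congr rfl fun j _ ↦ ?_
    ring

/-- With ℓ = 2q + 1, each derivative adds ℓ + 1 ≡ 2 to the weight mod 2q. The classes of D^j f and D
f therefore agree only if q ∣ j - 1. -/
lemma filter_Ico_modEq {q n : ℕ} (hq : 2 ≤ q) :
    {j ∈ Finset.Ico 1 (2 * q + 1) | n + j * (2 * q + 1 + 1) ≡ n + 1 * (2 * q + 1 + 1)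
      [MOD 2 * q + 1 - 1]} = {1, q + 1} := by
  ext j
  simp only [Finset.mem_filter, Finset.mem_Ico, Finset.mem_insert, Finset.mem_singleton,
    Nat.add_sub_cancel]
  constructor
  · rintro ⟨⟨h1, h2⟩, h⟩
    obtain ⟨i, rfl⟩ := Nat.exists_eq_add_of_le h1
    have h3 := (Nat.modEq_iff_dvd' (by nlinarith)).mp h.symm
    rw [show n + (1 + i) * (2 * q + 1 + 1) - (n + 1 * (2 * q + 1 + 1)) = 2 * ((q + 1) * i) by
      rw [Nat.sub_eq_iff_eq_add (by nlinarith)]; ring] at h3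
    have h4 := Nat.dvd_of_mul_dvd_mul_left two_pos h3
    have h5 : q ∣ i := Nat.Coprime.dvd_of_dvd_mul_left (by simp) h4
    obtain ⟨t, rfl⟩ := h5
    have : t < 2 := by
      by_contra ht
      nlinarith
    interval_cases t <;> omega
  · rintro (rfl | rfl)
    · exact ⟨by omega, Nat.ModEq.refl _⟩
    · refine ⟨by omega, Nat.ModEq.symm ((Nat.modEq_iff_dvd' (by nlinarith)).mpr ⟨q + 1, ?_⟩)⟩
      rw [Nat.sub_eq_iff_eq_add (by nlinarith)]
      ring

/-- A form with a simple congruence satisfies `D ^ ((ℓ + 1) / 2) f ≡ u D f`. -/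
lemma iterate_thetaLift_eq (hℓ : 5 ≤ ℓ) (hA : IsWeightedHomogeneous wt A (ℓ - 1))
    (hA1 : phi ℓ A = 1) {f : MvPolynomial (Fin 2) (ZMod ℓ)} {n q : ℕ}
    (hf : IsWeightedHomogeneous wt f n) (hq : ℓ = 2 * q + 1) {c : ZMod ℓ} (hc : c ≠ 0)
    (hfc : ∀ n : ℕ, (12 * n : ZMod ℓ) = c → (phi ℓ f).coeff n = 0) :
    ∃ u : ZMod ℓ, u ≠ 0 ∧ (thetaLift A)^[q + 1] f = C u * A ^ (q + 1) * thetaLift A f := by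
  have hq2 : 2 ≤ q := by omega
  have h1 := sum_phi_eq_zero_of_class hℓ hA hA1 (Finset.Ico 1 ℓ)
    (fun j ↦ C (c ^ (ℓ - 1 - j)) * (thetaLift A)^[j] f) (fun j ↦ n + j * (ℓ + 1))
    (fun j _ ↦ (homogeneous_iterate_thetaLift hℓ hA hf j).C_mul _)
    (sum_phi_iterate_thetaLift_eq_zero hℓ hA hA1 f hc hfc) (n + 1 * (ℓ + 1))
  have hfilter : {j ∈ Finset.Ico 1 ℓ | n + j * (ℓ + 1) ≡ n + 1 * (ℓ + 1) [MOD ℓ - 1]} =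
      {1, q + 1} := by
    have := filter_Ico_modEq (n := n) hq2
    rwa [← hq] at this
  rw [hfilter, Finset.sum_pair (by omega), show ℓ - 1 - 1 = q - 1 + q by omega,
    show ℓ - 1 - (q + 1) = q - 1 by omega, Function.iterate_one] at h1
  -- The two surviving coefficients are c^(2q-1) and c^(q-1). The factor A^(q+1) equalizes weights,
  -- since q(ℓ + 1) = (q + 1)(ℓ - 1).
  refine ⟨-c ^ q, neg_ne_zero.mpr (pow_ne_zero _ hc), ?_⟩
  refine eq_of_phi_eq hℓ hA hA1 (homogeneous_iterate_thetaLift hℓ hA hf (q + 1)) ?_ ?_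
  · have := ((hA.pow (q + 1)).C_mul (-c ^ q)).mul (homogeneous_thetaLift hℓ hA hf)
    convert this using 1
    rw [hq, Nat.add_sub_cancel, smul_eq_mul]
    ring
  · have h2 : PowerSeries.C (c ^ (q - 1)) * (phi ℓ ((thetaLift A)^[q + 1] f) -
        phi ℓ (C (-c ^ q) * A ^ (q + 1) * thetaLift A f)) = 0 := by
      simp only [map_mul, map_pow, map_neg, phi_C, hA1, pow_add] at h1 ⊢
      linear_combination h1
    rw [mul_eq_zero, map_eq_zero_iff _ PowerSeries.C_injective, sub_eq_zero] at h2
    exact h2.resolve_left (pow_ne_zero _ hc)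

lemma not_dvd_add_of_mod_le {n : ℕ} {q : ℕ} (hb : n % (2 * q + 1) ≤ q)
    (hn : ¬ 2 * q + 1 ∣ n) {i : ℕ} (hi : i < q + 1) : ¬ 2 * q + 1 ∣ n + i := by
  rw [Nat.dvd_iff_mod_eq_zero] at hn ⊢
  rw [Nat.add_mod, Nat.mod_eq_of_lt (a := i) (by omega), Nat.mod_eq_of_lt (by omega)]
  omega

/-- The bounds on the weight of a form of exact filtration satisfying `D ^ ((ℓ + 1) / 2) f ≡ u D f`. -/
theorem weight_bounds (hℓ : 5 ≤ ℓ) (hA : IsWeightedHomogeneous wt A (ℓ - 1))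
    (hA1 : phi ℓ A = 1) {f : MvPolynomial (Fin 2) (ZMod ℓ)} {n q : ℕ}
    (hf : IsWeightedHomogeneous wt f n) (hq : ℓ = 2 * q + 1) (hAf : ¬ A ∣ f) (hn : ¬ ℓ ∣ n)
    {u : ZMod ℓ} (hu : u ≠ 0)
    (h : (thetaLift A)^[q + 1] f = C u * A ^ (q + 1) * thetaLift A f) :
    q + 1 ≤ n % ℓ ∧ n % ℓ ≤ n / ℓ + q + 2 := by
  have hq2 : 2 ≤ q := by omega
  have hA0 : A ≠ 0 := by rintro rfl; simp at hA1
  have hlow : q + 1 ≤ n % ℓ := by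
    by_contra! hb
    refine not_dvd_iterate_thetaLift hℓ hA hA1 hf hAf (q + 1) (fun i hi ↦ ?_) ?_
    · subst hq
      exact not_dvd_add_of_mod_le (by omega) hn hi
    · rw [h, pow_succ]
      exact ⟨C u * A ^ q * thetaLift A f, by ring⟩
  refine ⟨hlow, ?_⟩
  have hD := not_dvd_thetaLift hℓ hA hA1 hf hn hAf
  have hD0 : thetaLift A f ≠ 0 := fun h0 ↦ hD (h0 ▸ dvd_zero A)
  have hb : n % ℓ < ℓ := Nat.mod_lt _ (by omega)
  have hab := Nat.div_add_mod n ℓ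
  set a := n / ℓ
  set b := n % ℓ
  -- After m = ℓ - b derivatives the weight is ≡ 0 mod ℓ, so the (m + 1)-st may create factors A.
  -- Then r = q - m derivatives remain.
  obtain ⟨r, hr⟩ : ∃ r, q = r + (ℓ - b) := ⟨q - (ℓ - b), by omega⟩
  obtain ⟨m, hm⟩ : ∃ m, m = ℓ - b := ⟨_, rfl⟩
  rw [← hm] at hr
  have hiter : (thetaLift A)^[r] ((thetaLift A)^[m + 1] f) =
      C u * A ^ (q + 1) * thetaLift A f := by
    rw [← h, ← Function.iterate_add_apply, hr, add_assoc]
  have hg0 : (thetaLift A)^[m + 1] f ≠ 0 := by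
    intro h0
    rw [h0, iterate_map_zero, eq_comm, mul_eq_zero, mul_eq_zero] at hiter
    rcases hiter with (h1 | h1) | h1
    · exact hu ((map_eq_zero_iff _ (C_injective _ _)).mp h1)
    · exact pow_ne_zero _ hA0 h1
    · exact hD0 h1
  have hAunit : ¬ IsUnit A := not_isUnit_of_homogeneous (n := ℓ - 1) (by omega) hA
  obtain ⟨g, hg, hAg⟩ :=
    (FiniteMultiplicity.of_not_isUnit hAunit hg0).exists_eq_pow_mul_and_not_dvd
  set s := multiplicity A ((thetaLift A)^[m + 1] f)
  obtain ⟨v, W, hv, hW, hvW⟩ := homogeneous_of_mul (hg ▸ hg0)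
    (hg ▸ homogeneous_iterate_thetaLift hℓ hA hf (m + 1))
  have hvs : s * (2 * q) = v := by
    have := (hA.pow s).inj_right (pow_ne_zero s hA0) hv
    rwa [smul_eq_mul, hq, Nat.add_sub_cancel] at this
  have hbm : b + m = 2 * q + 1 := by omega
  have hWs : s * (2 * q) + W = (a + m + 2) * (2 * q + 1) + 1 := by
    rw [hvs, hvW, ← hab, hq]
    linear_combination hbm
  -- The cofactor g has weight W ≡ 1 + s mod ℓ. If s ≤ q, the weights 1 + s + i with i < r stay
  -- below ℓ, so no new factor A appears, although the functional equation demands q + 1 - s more.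
  have hsq : q + 1 ≤ s := by
    by_contra! hs
    refine not_dvd_iterate_thetaLift hℓ hA hA1 hW hAg r (fun i hi hdvd ↦ ?_) ?_
    · have h1 : W + i + ℓ * s = ℓ * (a + m + 2) + (1 + s + i) := by
        rw [hq]; linear_combination hWs
      have h2 : ℓ ∣ 1 + s + i := by
        rw [← Nat.dvd_add_right (dvd_mul_right ℓ (a + m + 2)), ← h1]
        exact dvd_add hdvd (dvd_mul_right _ _)
      have := Nat.le_of_dvd (by omega) h2
      omega
    · rw [hg, iterate_thetaLift_hasse_pow_mul hℓ hA] at hiter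
      obtain ⟨t, ht⟩ := Nat.exists_eq_add_of_lt hs
      rw [ht] at hiter
      have h1 : A ^ s * (thetaLift A)^[r] g = A ^ s * (A * (C u * A ^ t * thetaLift A f)) := by
        rw [hiter]; ring
      rw [mul_left_cancel₀ (pow_ne_zero s hA0) h1]
      exact dvd_mul_right _ _
  by_contra! hlt
  have h1 : a + m + 2 ≤ q := by omega
  -- Since W ≥ 0, the s factors A weigh at least (q + 1) · 2q in a total of at most q(2q + 1) + 1,
  -- impossible for q ≥ 2.
  nlinarith [Nat.mul_le_mul_right (2 * q) hsq, Nat.mul_le_mul_right (2 * q + 1) h1]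

end Bounds

/-! ### Filtration and divisibility by the Hasse invariant -/

section Filtration

open MvPolynomial

variable {ℓ : ℕ} [Fact ℓ.Prime]

lemma exists_of_filtration_eq {f : PowerSeries (ZLoc ℓ)} {w : ℤ}
    (h : filtration ℓ f = ((w : WithTop ℤ) : WithBot (WithTop ℤ))) :
    (∃ g ∈ M ℓ w, CongrMod ℓ f g) ∧ ∀ k, ∀ g ∈ M ℓ k, CongrMod ℓ f g → w ≤ k := by
  have hle : ∀ k, ∀ g ∈ M ℓ k, CongrMod ℓ f g → w ≤ k := by
    intro k g hg hfg
    have : filtration ℓ f ≤ ((k : WithTop ℤ) : WithBot (WithTop ℤ)) :=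
      sInf_le ⟨k, rfl, g, hg, hfg⟩
    rw [h] at this
    exact_mod_cast this
  refine ⟨?_, hle⟩
  by_contra hw
  -- A finite infimum of integers is attained: otherwise w + 1 would also be a lower bound.
  have : (((w + 1 : ℤ) : WithTop ℤ) : WithBot (WithTop ℤ)) ≤ filtration ℓ f := by
    refine le_sInf ?_
    rintro x ⟨k, rfl, g, hg, hfg⟩
    have h1 := hle k g hg hfg
    have h2 : w ≠ k := by
      rintro rfl
      exact hw ⟨g, hg, hfg⟩
    have h3 : w + 1 ≤ k := by omega
    exact_mod_cast h3
  rw [h] at this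
  have h4 : w + 1 ≤ w := by exact_mod_cast this
  omega

/-- A series of filtration `w` is the reduction of a polynomial of weight `w` that is not
divisible by the Hasse invariant. -/
lemma exists_polynomial_of_filtration_eq (hℓ : 5 ≤ ℓ) {A : MvPolynomial (Fin 2) (ZMod ℓ)}
    (hA : IsWeightedHomogeneous wt A (ℓ - 1)) (hA1 : phi ℓ A = 1) {f : PowerSeries (ZLoc ℓ)}
    {w : ℤ} (h : filtration ℓ f = ((w : WithTop ℤ) : WithBot (WithTop ℤ))) :
    ∃ n : ℕ, w = n ∧ ∃ p, IsWeightedHomogeneous wt p n ∧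
      phi ℓ p = PowerSeries.map (red ℓ) f ∧ ¬ A ∣ p := by
  obtain ⟨⟨g, hg, hfg⟩, hmin⟩ := exists_of_filtration_eq h
  have hf0 : ¬ CongrMod ℓ f 0 := fun h0 ↦ by
    have := hmin (w - 1) 0 (zero_mem_M _) h0
    omega
  have hw : 0 ≤ w := by
    by_contra! hw
    exact hf0 (eq_zero_of_mem_M_of_neg hw hg ▸ hfg)
  lift w to ℕ using hw with n
  obtain ⟨p, hp, hpg⟩ := exists_homogeneous_of_mem_M hℓ n g hg
  rw [← congrMod_iff.mp hfg] at hpg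
  refine ⟨n, rfl, p, hp, hpg, ?_⟩
  rintro ⟨r, rfl⟩
  have hne : A * r ≠ 0 := by
    intro h0
    rw [h0, map_zero] at hpg
    exact hf0 (congrMod_iff.mpr (by rw [← hpg, map_zero]))
  obtain ⟨a, b, ha, hb, hab⟩ := homogeneous_of_mul hne hp
  have := ha.inj_right (left_ne_zero_of_mul hne) hA
  obtain ⟨g', hg', hg'r⟩ := exists_mem_M_of_homogeneous hb
  have := hmin b g' hg' (congrMod_iff.mpr (by rw [← hpg, hg'r, map_mul, hA1, one_mul]))
  omega

lemma coeff_eq_zero_of_hasSimpleCongruence {f : PowerSeries (ZLoc ℓ)} {c : ℤ}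
    (hcong : HasSimpleCongruence ℓ (f : LaurentSeries (ZLoc ℓ)) c) {n : ℕ}
    (hn : (n : ZMod ℓ) = c) : (PowerSeries.map (red ℓ) f).coeff n = 0 := by
  obtain ⟨t, ht⟩ : (ℓ : ℤ) ∣ n - c := by
    rw [← ZMod.intCast_zmod_eq_zero_iff_dvd]
    simp [hn]
  have h := hcong t
  rw [show (ℓ : ℤ) * t + c = n by omega, PowerSeries.coeff_coe, if_neg (by omega), Int.natAbs_natCast] at h
  rwa [PowerSeries.coeff_map, red_eq_zero_iff]

end Filtration

end SimpleCongruence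

theorem mainTheorem3 (ℓ : ℕ) [Fact ℓ.Prime] (hℓ : 5 ≤ ℓ) (k : ℤ)
    (f : PowerSeries (SimpleCongruence.ZLoc ℓ)) (hf : f ∈ SimpleCongruence.M ℓ k)
    (c : ℤ) (hc : ¬ (ℓ : ℤ) ∣ c)
    (hcong : SimpleCongruence.HasSimpleCongruence ℓ
      (f : LaurentSeries (SimpleCongruence.ZLoc ℓ)) c)
    (A B : ℤ) (hB1 : 1 ≤ B) (hB2 : B ≤ (ℓ : ℤ) - 1)
    (hω : SimpleCongruence.filtration ℓ f =
      (((A * (ℓ : ℤ) + B : ℤ) : WithTop ℤ) : WithBot (WithTop ℤ))) :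
    ((ℓ : ℚ) + 1) / 2 ≤ (B : ℚ) ∧ (B : ℚ) ≤ (A : ℚ) + ((ℓ : ℚ) + 3) / 2 := by
  open SimpleCongruence in
  obtain ⟨H, hH, hH1⟩ := exists_phi_eq_one hℓ
  obtain ⟨n, hn, p, hp, hpf, hHp⟩ := exists_polynomial_of_filtration_eq hℓ hH hH1 hω
  obtain ⟨q, hq⟩ : ∃ q, ℓ = 2 * q + 1 := (Fact.out : ℓ.Prime).odd_of_ne_two (by omega)
  -- The range of B makes A and B the Euclidean quotient and remainder of the filtration.
  have hdm : (n : ℤ) / ℓ = A ∧ (n : ℤ) % ℓ = B :=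
    (Int.ediv_emod_unique (by omega)).mpr ⟨by rw [← hn]; ring, by omega, by omega⟩
  have hnℓ : ¬ ℓ ∣ n := by
    rw [Nat.dvd_iff_mod_eq_zero]
    omega
  have h12 : (12 : ZMod ℓ) ≠ 0 := by
    exact_mod_cast intCast_ne_zero_of_five_le hℓ (n := 12) (a := 2) (b := 1) (by norm_num)
  -- The residue is scaled by 12 because `thetaLift` lifts 12 q d/dq.
  have hcℓ : (12 * c : ZMod ℓ) ≠ 0 :=
    mul_ne_zero h12 (by rwa [Ne, ZMod.intCast_zmod_eq_zero_iff_dvd])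
  obtain ⟨u, hu, hiter⟩ := iterate_thetaLift_eq hℓ hH hH1 hp hq hcℓ fun n hn ↦ by
    rw [hpf]
    exact coeff_eq_zero_of_hasSimpleCongruence hcong (mul_left_cancel₀ h12 hn)
  obtain ⟨h1, h2⟩ := weight_bounds hℓ hH hH1 hp hq hHp hnℓ hu hiter
  have h3 : (q : ℤ) + 1 ≤ B := by omega
  have h4 : B ≤ A + q + 2 := by
    rw [← hdm.1, ← hdm.2]
    exact_mod_cast h2
  have hqq : (ℓ : ℚ) = 2 * q + 1 := by exact_mod_cast hq
  have h3' : (q : ℚ) + 1 ≤ B := by exact_mod_cast h3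
  have h4' : (B : ℚ) ≤ A + q + 2 := by exact_mod_cast h4
  constructor <;> linarith
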